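/- Let $p$ be a prime, $G$ a finite group, $P$ a Sylow $p$-subgroup of $G$, and $F$ a field of characteristic $p$. Assume that $G$ has a normal $p$-complement $K$, that is, a normal subgroup $K$ with $p\nmid |K|$ and $|G:K|$ a power of $p$. Let $1_P^G$ denote the $FG$-module induced from the trivial $FP$-module, and let $\operatorname{Irr}(K)$ be the set of irreducible complex characters of $K$. For $\chi\in\operatorname{Irr}(K)$ put $\operatorname{Ker}\chi=\{x\in K\mid \chi(x)=\chi(1)\}$, a normal subgroup of $K$, and let $$\mathrm{I}_P(\chi)=\{g\in P\mid \chi(gxg^{-1})=\chi(x)\text{ for all }x\in K\}$$ be the inertia group of $\chi$ in $P$. Then $1_P^G$ is completely reducible if and only if, for every $\chi\in\operatorname{Irr}(K)$, the group $\mathrm{I}_P(\chi)$ acts trivially (by conjugation) on $K/\operatorname{Ker}\chi$, i.e. $gxg^{-1}\operatorname{Ker}\chi=x\operatorname{Ker}\chi$ for all $g\in \mathrm{I}_P(\chi)$ and $x\in K$. -/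

import Mathlib

/-- `χ : K → ℂ` is an irreducible (ordinary) character of `K`: it is the character of an irreducible
complex representation of `K` of some finite dimension `n`. -/
def IsIrrChar {K : Type*} [Group K] (χ : K → ℂ) : Prop :=
  ∃ (n : ℕ) (ρ : Representation ℂ K (Fin n → ℂ)), ρ.IsIrreducible ∧ ρ.character = χ

/-- `Irr(K)`, the set of irreducible complex characters of `K`. -/
def Irr (K : Type*) [Group K] : Set (K → ℂ) := {χ | IsIrrChar χ}

/-- A complex endomorphism of finite order whose trace is the dimension is the identity. -/
theorem eq_one_of_pow_eq_one_of_trace {V : Type*} [AddCommGroup V] [Module ℂ V]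
    [FiniteDimensional ℂ V] (f : Module.End ℂ V) (m : ℕ) (hm : 0 < m) (hf : f ^ m = 1)
    (ht : LinearMap.trace ℂ V f = Module.finrank ℂ V) : f = 1 := by
  have hsplit : f.charpoly.Splits := IsAlgClosed.splits _
  have hcard : f.charpoly.roots.card = Module.finrank ℂ V := by
    rw [← hsplit.natDegree_eq_card_roots, LinearMap.charpoly_natDegree]
  have hsum : f.charpoly.roots.sum = Module.finrank ℂ V := by
    rw [← ht, Module.End.trace_eq_sum_roots_charpoly_of_splits hsplit]
  have hnorm : ∀ μ ∈ f.charpoly.roots, ‖μ‖ = 1 := by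
    intro μ hμ
    have hev : f.HasEigenvalue μ :=
      (Module.End.hasEigenvalue_iff_isRoot_charpoly f μ).2 (Polynomial.isRoot_of_mem_roots hμ)
    obtain ⟨v, hv⟩ := hev.exists_hasEigenvector
    have h1 := hv.pow_apply m
    rw [hf, Module.End.one_apply] at h1
    have h2 : (μ ^ m - 1) • v = 0 := by rw [sub_smul, ← h1, one_smul, sub_self]
    have h3 : μ ^ m = 1 := by
      rcases smul_eq_zero.1 h2 with h | h
      · exact sub_eq_zero.1 h
      · exact absurd h hv.2
    exact Complex.norm_eq_one_of_pow_eq_one h3 hm.ne'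
  have hre : (f.charpoly.roots.map fun μ => 1 - μ.re).sum = 0 := by
    rw [Multiset.sum_map_sub]
    have : (f.charpoly.roots.map Complex.re).sum = f.charpoly.roots.sum.re := by
      exact (map_multiset_sum Complex.reAddGroupHom f.charpoly.roots).symm
    rw [this, hsum]
    simp [hcard]
  have hroot : ∀ μ ∈ f.charpoly.roots, μ = 1 := by
    intro μ hμ
    have h0 : ∀ x ∈ f.charpoly.roots.map (fun μ => 1 - μ.re), 0 ≤ x := by
      intro x hx
      obtain ⟨ν, hν, rfl⟩ := Multiset.mem_map.1 hx
      have := Complex.re_le_norm ν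
      rw [hnorm ν hν] at this
      linarith
    have h1 : 1 - μ.re ≤ 0 := by
      rw [← hre]
      exact Multiset.single_le_sum h0 _ (Multiset.mem_map_of_mem _ hμ)
    have h2 : μ.re = 1 := by
      have := Complex.re_le_norm μ
      rw [hnorm μ hμ] at this
      linarith
    have h3 : μ.im = 0 := by
      have h4 := Complex.sq_norm μ
      rw [hnorm μ hμ, Complex.normSq_apply, h2] at h4
      nlinarith
    exact Complex.ext h2 h3
  have hchar : f.charpoly = (Polynomial.X - Polynomial.C 1) ^ Module.finrank ℂ V := by
    rw [hsplit.eq_prod_roots_of_monic f.charpoly_monic,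
      Multiset.eq_replicate.2 ⟨hcard, hroot⟩]
    simp
  have hnil : IsNilpotent (f - 1) := by
    refine ⟨Module.finrank ℂ V, ?_⟩
    have := f.aeval_self_charpoly
    rw [hchar] at this
    simpa using this
  have hss : f.IsSemisimple := by
    refine Module.End.isSemisimple_of_squarefree_aeval_eq_zero
      (p := Polynomial.X ^ m - Polynomial.C 1) ?_ (by simp [hf])
    exact (Polynomial.separable_X_pow_sub_C (1 : ℂ) (by exact_mod_cast hm.ne')
      one_ne_zero).squarefree
  have hss' : (f - 1).IsSemisimple := by
    have := Module.End.isSemisimple_sub_algebraMap_iff (f := f) (μ := (1 : ℂ))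
    rw [map_one] at this
    exact this.2 hss
  exact sub_eq_zero.1 (Module.End.eq_zero_of_isNilpotent_isSemisimple hnil hss')

/-- For an irreducible character afforded by `ρ`, the value at `x` is the degree iff `ρ x = 1`. -/
theorem character_eq_character_one_iff {K : Type*} [Group K] [Finite K] {n : ℕ}
    (ρ : Representation ℂ K (Fin n → ℂ)) (x : K) :
    ρ.character x = ρ.character 1 ↔ ρ x = 1 := by
  constructor
  · intro h
    refine eq_one_of_pow_eq_one_of_trace (ρ x) (orderOf x) (orderOf_pos x) ?_ ?_
    · rw [← map_pow, pow_orderOf_eq_one, map_one]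
    · rw [Representation.char_one] at h
      exact h
  · intro h
    simp only [Representation.character, h, map_one]

/-- The kernel `Ker χ = {x ∈ K | χ(x) = χ(1)}` of an irreducible character `χ` of `K`. -/
def Irr.ker {K : Type*} [Group K] [Finite K] (χ : Irr K) : Subgroup K where
  carrier := {x | χ.1 x = χ.1 1}
  one_mem' := rfl
  mul_mem' := by
    obtain ⟨χ, n, ρ, -, rfl⟩ := χ
    intro x y hx hy
    simp only [Set.mem_ofPred_eq, character_eq_character_one_iff] at hx hy ⊢
    rw [map_mul, hx, hy, one_mul]
  inv_mem' := by
    obtain ⟨χ, n, ρ, -, rfl⟩ := χ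
    intro x hx
    simp only [Set.mem_ofPred_eq, character_eq_character_one_iff] at hx ⊢
    have h : ρ (x⁻¹ * x) = 1 := by rw [inv_mul_cancel, map_one]
    rwa [map_mul, hx, mul_one] at h

instance {K : Type*} [Group K] [Finite K] (χ : Irr K) : (Irr.ker χ).Normal where
  conj_mem := by
    obtain ⟨χ, n, ρ, -, rfl⟩ := χ
    intro x hx g
    have hx' : ρ.character x = ρ.character 1 := hx
    change ρ.character (g * x * g⁻¹) = ρ.character 1
    rw [ρ.char_conj, hx']

/-- `K` is a `p`-complement of the finite group `G`: its order is prime to `p` and its index is a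
power of `p`. -/
def IsPComplement (p : ℕ) {G : Type*} [Group G] (K : Subgroup G) : Prop :=
  ¬ p ∣ Nat.card K ∧ ∃ n : ℕ, K.index = p ^ n

/-- The inertia group `I_P(χ) = {g ∈ P | χ(g x g⁻¹) = χ(x) for all x ∈ K}` of a function `χ` on the
normal subgroup `K` of `G`, in the subgroup `P` of `G`. -/
def inertiaGroup {G : Type*} [Group G] (P K : Subgroup G) [K.Normal] (χ : K → ℂ) :
    Subgroup G where
  carrier := {g | g ∈ P ∧ ∀ x : K, χ (MulAut.conjNormal g x) = χ x}
  one_mem' := ⟨P.one_mem, fun x => by simp⟩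
  mul_mem' := by
    rintro a b ⟨ha, ha'⟩ ⟨hb, hb'⟩
    exact ⟨P.mul_mem ha hb, fun x => by rw [map_mul, MulAut.mul_apply, ha', hb']⟩
  inv_mem' := by
    rintro a ⟨ha, ha'⟩
    refine ⟨P.inv_mem ha, fun x => ?_⟩
    rw [← ha' (MulAut.conjNormal a⁻¹ x), ← MulAut.mul_apply, ← map_mul, mul_inv_cancel, map_one,
      MulAut.one_apply]

/-- The induced module `1_P^G` over the field `F`: the `G`-representation induced from the trivial
one-dimensional representation of `P`. -/
noncomputable def inducedTrivial (F : Type*) [Field F] {G : Type*} [Group G] (P : Subgroup G) :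
    Representation F G (Representation.IndV P.subtype (Representation.trivial F P F)) :=
  Representation.ind P.subtype (Representation.trivial F P F)

/-! Since G = KP, letting K act on the generator identifies 1_P^G with FK, on which K acts by left
multiplication and P by conjugation (`toInduced_bijective`). Submodules become P-stable left ideals,
and complete reducibility means that each of them contains a P-fixed right identity
(`hasInvariantIdempotents_iff`). Only the p-group Q of automorphisms of K induced by P matters.

Characters enter as central characters, the algebra maps l from the centre of EK to E. The condition
on φ in Q is that every l fixed by φ is trivial on [K, φ], the smallest normal subgroup modulo which
φ is trivial. Over ℂ this is the condition on Irr(K), one φ at a time. It is the same over every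
algebraically closed E whose characteristic does not divide |K|
(`fixedCentralCharactersTrivialOn_congr`): characters trivial on [K, φ] are always fixed, so the
condition equates two cardinalities. One is the dimension of a subspace of the centre with a
field-free description. The other is determined by the orbit counts of the powers of φ, again such
dimensions, because φ has p-power order.

If the condition holds, then over the algebraic closure of F the stabilizer in Q of a block of the
group algebra acts trivially on that block. A right identity of a stable left ideal can therefore be
cut down to one block per orbit and transported along the orbit, giving a fixed right identity. A
linear retraction brings this down to F.

Conversely, semisimplicity descends to the prime field and, by Clifford's theorem along a subnormal
chain, from Q to the subgroup generated by φ. If φ fixes l, it fixes the centre of the corresponding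
block, a matrix algebra over a finite field. By Skolem–Noether it acts there as conjugation by some
u, which can be rescaled so that u^(p^a) = 1. Then n = u - 1 is nilpotent and generates a stable
left ideal; a fixed right identity of it commutes with n, which forces n = 0
(`HasInvariantIdempotents.eq_of_inner`). So φ is trivial on the block and l is trivial on [K, φ]. -/

/-! ### Counting orbits and fixed points. -/

/-- The functions `α → E` that are constant along a relation `R`. -/
def invariantFunctions (E : Type*) [Field E] {α : Type*} (R : α → α → Prop) :
    Submodule E (α → E) where
  carrier := {f | ∀ x y, R x y → f x = f y}
  add_mem' := fun hf hg x y h => by simp [hf x y h, hg x y h]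
  zero_mem' := fun _ _ _ => rfl
  smul_mem' := fun c f hf x y h => by simp [hf x y h]

theorem finrank_invariantFunctions (E : Type*) [Field E] {α : Type*} [Finite α]
    (R : α → α → Prop) :
    Module.finrank E (invariantFunctions E R) = Nat.card (Quot R) := by
  have : Fintype (Quot R) := Fintype.ofFinite _
  let e : (Quot R → E) ≃ₗ[E] invariantFunctions E R :=
    { toFun := fun f => ⟨fun x => f (Quot.mk R x), fun x y h => congrArg f (Quot.sound h)⟩
      invFun := fun f => Quot.lift f.1 f.2
      left_inv := fun f => by ext x; induction x using Quot.ind; rfl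
      right_inv := fun f => rfl
      map_add' := fun _ _ => rfl
      map_smul' := fun _ _ => rfl }
  rw [← e.finrank_eq, Module.finrank_fintype_fun_eq_card, Nat.card_eq_fintype_card]

theorem Submodule.finrank_map_of_injective {E V W : Type*} [Field E] [AddCommGroup V] [Module E V]
    [AddCommGroup W] [Module E W] (f : V →ₗ[E] W) (hf : Function.Injective f)
    (S : Submodule E V) : Module.finrank E (S.map f) = Module.finrank E S :=
  (Submodule.equivMapOfInjective f hf S).finrank_eq.symm

/-- Dimensions count orbits: one subspace described in two coordinate systems equates two orbit
counts. The coordinates will be group elements and central characters. -/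
theorem card_quot_eq_of_map_eq {E V α β : Type*} [Field E] [AddCommGroup V] [Module E V]
    [Finite α] [Finite β] {R : α → α → Prop} {S : β → β → Prop}
    (f : (α → E) →ₗ[E] V) (g : (β → E) →ₗ[E] V)
    (hf : Function.Injective f) (hg : Function.Injective g)
    (h : (invariantFunctions E R).map f = (invariantFunctions E S).map g) :
    Nat.card (Quot R) = Nat.card (Quot S) := by
  rw [← finrank_invariantFunctions E R, ← finrank_invariantFunctions E S,
    ← Submodule.finrank_map_of_injective f hf, h, Submodule.finrank_map_of_injective g hg]

theorem quot_mk_zpow_apply {X : Type*} (s : Equiv.Perm X) (k : ℤ) (x : X) :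
    Quot.mk (fun x y => s x = y) ((s ^ k) x) = Quot.mk (fun x y => s x = y) x := by
  induction k with
  | zero => rfl
  | succ k ih =>
    rw [← ih, add_comm, zpow_add, zpow_one, Equiv.Perm.mul_apply]
    exact (Quot.sound (r := fun x y => s x = y) rfl).symm
  | pred k ih =>
    rw [← ih]
    refine Quot.sound ?_
    rw [← Equiv.Perm.mul_apply, ← zpow_one_add]
    congr 2
    ring

/-- Burnside's lemma for a cyclic group of permutations. -/
theorem sum_card_fixed_zpowers {Γ X : Type*} [Group Γ] [Finite X]
    (π : Γ →* Equiv.Perm X) (c : Γ) [Fintype (Subgroup.zpowers c)] :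
    ∑ γ : Subgroup.zpowers c, Nat.card {x // π γ x = x} =
      Nat.card (Quot fun x y => π c x = y) * Nat.card (Subgroup.zpowers c) := by
  classical
  let H := Subgroup.zpowers c
  let _ : MulAction H X := MulAction.compHom X (π.comp H.subtype)
  have : Fintype X := Fintype.ofFinite X
  have : Fintype (Quotient (MulAction.orbitRel H X)) := Fintype.ofFinite _
  have key := MulAction.sum_card_fixedBy_eq_card_orbits_mul_card_group H X
  simp only [← Nat.card_eq_fintype_card] at key
  have hq : Nat.card (Quot fun x y => π c x = y) =
      Nat.card (Quotient (MulAction.orbitRel H X)) := by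
    refine Nat.card_congr
      { toFun := Quot.lift (fun x => (Quotient.mk _ x : Quotient (MulAction.orbitRel H X))) ?_
        invFun := Quotient.lift (fun x => Quot.mk _ x) ?_
        left_inv := fun x => by induction x using Quot.ind; rfl
        right_inv := fun x => by induction x using Quotient.ind; rfl }
    · rintro x y rfl
      exact (Quotient.sound (s := MulAction.orbitRel H X)
        ⟨⟨c, Subgroup.mem_zpowers c⟩, rfl⟩).symm
    · rintro x y ⟨⟨_, k, rfl⟩, rfl⟩
      change Quot.mk _ (π (c ^ k) y) = _
      rw [map_zpow]
      exact quot_mk_zpow_apply (π c) k y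
  rw [hq]
  exact key

theorem card_fixed_eq_of_pow_eq {Γ X : Type*} [Group Γ] (π : Γ →* Equiv.Perm X) {b c : Γ}
    {i j : ℕ}
    (h1 : b = c ^ i) (h2 : c = b ^ j) :
    Nat.card {x // π b x = x} = Nat.card {x // π c x = x} := by
  refine Nat.card_congr (Equiv.subtypeEquivRight fun x => ⟨fun hx => ?_, fun hx => ?_⟩)
  · rw [h2, map_pow]
    exact Function.IsFixedPt.perm_pow hx j
  · rw [h1, map_pow]
    exact Function.IsFixedPt.perm_pow hx i

theorem card_quot_eq (Z : Type*) : Nat.card (Quot fun x y : Z => x = y) = Nat.card Z :=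
  Nat.card_congr ⟨Quot.lift id fun _ _ h => h, Quot.mk _, fun x => by
    induction x using Quot.ind; rfl, fun _ => rfl⟩

/-- Two permutations of `p`-power order whose powers have equally many orbits have equally many
fixed points. -/
theorem card_fixed_eq_of_card_orbits_eq {X Y : Type*} [Finite X] [Finite Y] {p a : ℕ}
    [Fact p.Prime] (s : Equiv.Perm X) (t : Equiv.Perm Y) (hs : s ^ p ^ a = 1) (ht : t ^ p ^ a = 1)
    (h : ∀ d : ℕ, Nat.card (Quot fun x y => (s ^ d) x = y) =
      Nat.card (Quot fun x y => (t ^ d) x = y)) :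
    Nat.card {x // s x = x} = Nat.card {y // t y = y} := by
  classical
  let Γ := Equiv.Perm X × Equiv.Perm Y
  -- The pair lets one cyclic group act on both sets.
  let c : Γ := (s, t)
  let πX : Γ →* Equiv.Perm X := MonoidHom.fst _ _
  let πY : Γ →* Equiv.Perm Y := MonoidHom.snd _ _
  have hc : c ^ p ^ a = 1 := Prod.ext hs ht
  have hp := Fact.out (p := p.Prime)
  have : Fintype Γ := Fintype.ofFinite Γ
  have hle : Subgroup.zpowers (c ^ p) ≤ Subgroup.zpowers c := by
    rw [Subgroup.zpowers_le]; exact Subgroup.npow_mem_zpowers c p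
  let S : Finset Γ := Finset.univ.filter (· ∈ Subgroup.zpowers c)
  let S' : Finset Γ := Finset.univ.filter (· ∈ Subgroup.zpowers (c ^ p))
  have hSS : S' ⊆ S := fun γ hγ => by
    simp only [S, S', Finset.mem_filter, Finset.mem_univ, true_and] at hγ ⊢
    exact hle hγ
  -- Elements of ⟨c⟩ outside ⟨c ^ p⟩ generate ⟨c⟩, so they have the same fixed points as c.
  -- Subtracting Burnside's count for ⟨c ^ p⟩ from that for ⟨c⟩ isolates them.
  have hgen : ∀ γ ∈ S \ S', ∃ i j : ℕ, γ = c ^ i ∧ c = γ ^ j := by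
    intro γ hγ
    simp only [S, S', Finset.mem_sdiff, Finset.mem_filter, Finset.mem_univ, true_and] at hγ
    obtain ⟨h1, h2⟩ := hγ
    rw [← mem_powers_iff_mem_zpowers] at h1
    obtain ⟨i, rfl⟩ := h1
    have hi : ¬ p ∣ i := by
      rintro ⟨k, rfl⟩
      refine h2 ?_
      change c ^ (p * k) ∈ _
      rw [pow_mul]
      exact Subgroup.npow_mem_zpowers _ k
    have hco : i.Coprime (orderOf c) :=
      (((Nat.Prime.coprime_iff_not_dvd hp).2 hi).symm.pow_right a).coprime_dvd_right
        (orderOf_dvd_of_pow_eq_one hc)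
    obtain ⟨j, hj⟩ := exists_pow_eq_self_of_coprime hco
    exact ⟨i, j, rfl, hj.symm⟩
  have hX : ∀ γ ∈ S \ S', Nat.card {x // πX γ x = x} = Nat.card {x // s x = x} := fun γ hγ => by
    obtain ⟨i, j, h1, h2⟩ := hgen γ hγ
    exact card_fixed_eq_of_pow_eq πX h1 h2
  have hY : ∀ γ ∈ S \ S', Nat.card {x // πY γ x = x} = Nat.card {x // t x = x} := fun γ hγ => by
    obtain ⟨i, j, h1, h2⟩ := hgen γ hγ
    exact card_fixed_eq_of_pow_eq πY h1 h2
  have sum_eq : ∀ (f : Γ → ℕ) (b : Γ),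
      ∑ γ ∈ Finset.univ.filter (· ∈ Subgroup.zpowers b), f γ =
      ∑ γ : Subgroup.zpowers b, f γ := fun f b => Finset.sum_subtype _ (by simp) _
  have hS : ∑ γ ∈ S, Nat.card {x // πX γ x = x} = ∑ γ ∈ S, Nat.card {y // πY γ y = y} := by
    rw [sum_eq, sum_eq, sum_card_fixed_zpowers, sum_card_fixed_zpowers]
    have := h 1
    simp only [pow_one] at this
    exact congrArg (· * _) this
  have hS' : ∑ γ ∈ S', Nat.card {x // πX γ x = x} = ∑ γ ∈ S', Nat.card {y // πY γ y = y} := by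
    rw [sum_eq, sum_eq, sum_card_fixed_zpowers, sum_card_fixed_zpowers]
    exact congrArg (· * _) (h p)
  rw [← Finset.sum_sdiff hSS, ← Finset.sum_sdiff (f := fun γ => Nat.card {y // πY γ y = y}) hSS,
    hS', Nat.add_right_cancel_iff, Finset.sum_congr rfl hX, Finset.sum_congr rfl hY,
    Finset.sum_const, Finset.sum_const, smul_eq_mul, smul_eq_mul] at hS
  -- The difference is empty only if c = 1; then the orbit counts at d = 0 compare the sizes of X
  -- and Y.
  rcases Nat.eq_zero_or_pos (S \ S').card with h0 | h0
  · have hc1 : c = 1 := by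
      have hmem : c ∈ Subgroup.zpowers (c ^ p) := by
        by_contra hcon
        have : c ∈ S \ S' := by
          simp only [S, S', Finset.mem_sdiff, Finset.mem_filter, Finset.mem_univ, true_and]
          exact ⟨Subgroup.mem_zpowers c, hcon⟩
        rw [Finset.card_eq_zero.1 h0] at this
        simp at this
      have heq : Subgroup.zpowers (c ^ p) = Subgroup.zpowers c :=
        le_antisymm hle (by rwa [Subgroup.zpowers_le])
      have hord : orderOf c / (orderOf c).gcd p = orderOf c := by
        rw [← orderOf_pow, ← Nat.card_zpowers, heq, Nat.card_zpowers]
      have hg : (orderOf c).gcd p = 1 := by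
        by_contra hne
        have h2 : 1 < (orderOf c).gcd p :=
          lt_of_le_of_ne (Nat.gcd_pos_of_pos_right _ hp.pos) (Ne.symm hne)
        exact absurd hord (Nat.div_lt_self (orderOf_pos c) h2).ne
      have : orderOf c = 1 := Nat.Coprime.eq_one_of_dvd
        (Nat.Coprime.pow_right a hg) (orderOf_dvd_of_pow_eq_one hc)
      exact orderOf_eq_one_iff.1 this
    obtain rfl : s = 1 := congrArg Prod.fst hc1
    obtain rfl : t = 1 := congrArg Prod.snd hc1
    have := h 0
    simp only [pow_zero, Equiv.Perm.one_apply, card_quot_eq] at this ⊢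
    simpa [Nat.card_congr (Equiv.subtypeUnivEquiv fun _ => trivial)] using this
  · exact Nat.eq_of_mul_eq_mul_left h0 hS

/-! ### Points of commutative algebras and of centres. -/

/-- A finite reduced commutative algebra over an algebraically closed field is the algebra of
functions on its set of points. -/
theorem bijective_eval_algHom (E R : Type*) [Field E] [IsAlgClosed E] [CommRing R] [Algebra E R]
    [Module.Finite E R] [IsReduced R] :
    Function.Bijective (LinearMap.pi fun l : R →ₐ[E] E => l.toLinearMap) := by
  have : IsArtinianRing R := IsArtinianRing.of_finite E R
  constructor
  · rw [← LinearMap.ker_eq_bot, LinearMap.ker_eq_bot']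
    intro x hx
    have hm : x ∈ nilradical R := by
      rw [IsArtinianRing.nilradical_eq_iInf, Ideal.mem_iInf]
      intro m
      have := m.isMaximal
      let _ : Field (R ⧸ m.asIdeal) := Ideal.Quotient.field m.asIdeal
      -- Each residue field embeds in E, so an element killed by all points lies in every maximal
      -- ideal.
      let f : (R ⧸ m.asIdeal) →ₐ[E] E := IsAlgClosed.lift
      have := congrFun hx (f.comp (Ideal.Quotient.mkₐ E m.asIdeal))
      rw [← Ideal.Quotient.eq_zero_iff_mem]
      exact f.toRingHom.injective (by simpa using this)
    rwa [nilradical_eq_zero] at hm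
  · rw [← LinearMap.range_eq_top]
    by_contra hne
    have : Finite (R →ₐ[E] E) := inferInstance
    have : Fintype (R →ₐ[E] E) := Fintype.ofFinite _
    -- A functional vanishing on a proper range would be a linear relation between distinct points,
    -- against Dedekind's independence of characters.
    obtain ⟨f, hf0, hf⟩ := Submodule.exists_le_ker_of_lt_top _ (lt_top_iff_ne_top.2 hne)
    have li := linearIndependent_toLinearMap E R E
    rw [Fintype.linearIndependent_iff] at li
    classical
    have hz := li (fun l => f (Pi.single l 1)) (by
      ext x
      have h1 := hf ⟨x, rfl⟩
      rw [LinearMap.mem_ker, LinearMap.pi_apply_eq_sum_univ] at h1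
      have hs : ∀ l : R →ₐ[E] E, (fun j => if l = j then (1 : E) else 0) = Pi.single l 1 :=
        fun l => by ext j; simp [Pi.single_apply, eq_comm]
      simpa [hs, mul_comm] using h1)
    refine hf0 (LinearMap.pi_ext' fun l => LinearMap.ext_ring ?_)
    simpa using hz l

/-- The endomorphism of the centre of an algebra induced by an automorphism of the algebra. -/
def centerMap {E A : Type*} [CommSemiring E] [Semiring A] [Algebra E A] (e : A ≃ₐ[E] A) :
    Subalgebra.center E A →ₐ[E] Subalgebra.center E A :=
  ((e : A →ₐ[E] A).comp (Subalgebra.center E A).val).codRestrict _ fun z => by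
    rw [Subalgebra.mem_center_iff]
    intro b
    have h := Subalgebra.mem_center_iff.1 z.2 (e.symm b)
    have := congrArg e h
    simpa using this

theorem coe_centerMap {E A : Type*} [CommSemiring E] [Semiring A] [Algebra E A] (e : A ≃ₐ[E] A)
    (z : Subalgebra.center E A) : (centerMap e z : A) = e z := rfl

/-- Splitting 1 along the left ideal Az and a complement gives y with z y z = z. As z is central,
z^(k+1) y^k = z for all k, so a nilpotent z vanishes. -/
theorem isReduced_center (E A : Type*) [Field E] [Ring A] [Algebra E A] [IsSemisimpleRing A] :
    IsReduced (Subalgebra.center E A) := by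
  constructor
  rintro z ⟨n, hn⟩
  have hc : ∀ b : A, b * z = z * b := Subalgebra.mem_center_iff.1 z.2
  obtain ⟨L, hL⟩ := exists_isCompl (Ideal.span {(z : A)})
  obtain ⟨e, he, f, hf, hef⟩ := Submodule.mem_sup.1
    (hL.sup_eq_top ▸ Submodule.mem_top : (1 : A) ∈ Ideal.span {(z : A)} ⊔ L)
  obtain ⟨y, rfl⟩ := Ideal.mem_span_singleton'.1 he
  have hz : (z : A) * f = 0 := by
    have h1 : (z : A) * f ∈ L := L.smul_mem _ hf
    have h2 : (z : A) * f ∈ Ideal.span {(z : A)} := by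
      rw [← hc f]; exact Ideal.mul_mem_left _ _ (Ideal.mem_span_singleton_self _)
    exact (Submodule.disjoint_def.1 hL.disjoint) _ h2 h1
  have h1 : (z : A) * (y * z) = z := by
    conv_rhs => rw [← mul_one (z : A), ← hef, mul_add, hz, add_zero]
  have h2 : ∀ k : ℕ, (z : A) ^ (k + 1) * y ^ k = z := by
    intro k
    induction k with
    | zero => simp
    | succ k ih =>
      have hcy : Commute (z : A) (y ^ k) := (hc _).symm
      calc (z : A) ^ (k + 1 + 1) * y ^ (k + 1) = z * (z ^ (k + 1) * y ^ k) * y := by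
            rw [pow_succ' _ (k + 1), pow_succ y k]; simp only [mul_assoc]
        _ = z := by rw [ih, mul_assoc, ← hc y, h1]
  have h3 : (z : A) ^ n = 0 := by simpa using congrArg Subtype.val hn
  apply Subtype.ext
  rw [← h2 n, pow_succ, h3]
  simp

/-! ### Central characters of the group algebra. -/

section GroupAlgebra

open MonoidAlgebra

/-- Functions on a finite type, as elements of the monoid algebra. -/
noncomputable def groupFun (E : Type*) [Field E] {α : Type*} [Finite α] :
    (α → E) →ₗ[E] MonoidAlgebra E α :=
  ((coeffLinearEquiv E).trans (Finsupp.linearEquivFunOnFinite E E α)).symm.toLinearMap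

theorem groupFun_injective (E : Type*) [Field E] {α : Type*} [Finite α] :
    Function.Injective (groupFun E (α := α)) :=
  LinearEquiv.injective _

theorem mem_map_groupFun_iff (E : Type*) [Field E] {α : Type*} [Finite α]
    (R : α → α → Prop) (a : MonoidAlgebra E α) :
    a ∈ (invariantFunctions E R).map (groupFun E) ↔
      ∀ x y, R x y → a.coeff x = a.coeff y := by
  constructor
  · rintro ⟨f, hf, rfl⟩
    exact hf
  · intro h
    exact ⟨a.coeff, h, LinearEquiv.symm_apply_apply _ a⟩

variable {K : Type*} [Group K]

/-- The automorphism of the group algebra of `K` induced by an automorphism of `K`. -/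
noncomputable abbrev algAut (E : Type*) [Field E] (φ : MulAut K) :
    MonoidAlgebra E K ≃ₐ[E] MonoidAlgebra E K :=
  domCongrAut (R := E) (A := E) φ

theorem algAut_single (E : Type*) [Field E] (φ : MulAut K) (x : K) (c : E) :
    algAut E φ (single x c) = single (φ x) c := by simp

theorem coeff_algAut (E : Type*) [Field E] (φ : MulAut K) (a : MonoidAlgebra E K) (x : K) :
    (algAut E φ a).coeff (φ x) = a.coeff x := by
  induction a using MonoidAlgebra.induction_linear with
  | zero => simp
  | add a b ha hb => simp only [map_add, coeff_add, Finsupp.add_apply, ha, hb]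
  | single y c =>
    classical
    simp [Finsupp.single_apply]

theorem mem_center_iff_single (E : Type*) [Field E] (a : MonoidAlgebra E K) :
    a ∈ Subalgebra.center E (MonoidAlgebra E K) ↔ ∀ g : K, single g 1 * a = a * single g 1 := by
  rw [Subalgebra.mem_center_iff]
  refine ⟨fun h g => h _, fun h b => ?_⟩
  induction b using MonoidAlgebra.induction_linear with
  | zero => simp
  | add b c hb hc => rw [add_mul, mul_add, hb, hc]
  | single g c =>
    have : (single g c : MonoidAlgebra E K) = c • single g 1 := by simp
    rw [this, smul_mul_assoc, mul_smul_comm, h]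

theorem mem_center_iff_coeff (E : Type*) [Field E] (a : MonoidAlgebra E K) :
    a ∈ Subalgebra.center E (MonoidAlgebra E K) ↔
      ∀ x y : K, IsConj x y → a.coeff x = a.coeff y := by
  rw [mem_center_iff_single]
  constructor
  · rintro h x y hxy
    obtain ⟨g, rfl⟩ := isConj_iff.1 hxy
    have := congrArg (fun b => b.coeff (g * x)) (h g)
    simpa [coeff_single_mul_apply, coeff_mul_single_apply] using this
  · intro h g
    ext x
    simp only [coeff_single_mul_apply, coeff_mul_single_apply, one_mul, mul_one]
    refine h _ _ (isConj_iff.2 ⟨g, ?_⟩)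
    group

/-- The idempotent of the group algebra given by the average over a subgroup. -/
noncomputable def averageIdem (E : Type*) [Field E] [Finite K] (N : Subgroup K) :
    MonoidAlgebra E K :=
  (Nat.card N : E)⁻¹ • ∑ᶠ n : N, single (n : K) 1

theorem single_mul_averageIdem (E : Type*) [Field E] [Finite K] (N : Subgroup K) {n : K}
    (hn : n ∈ N) : single n 1 * averageIdem E N = averageIdem E N := by
  have : Fintype N := Fintype.ofFinite N
  rw [averageIdem, mul_smul_comm, finsum_eq_sum_of_fintype, Finset.mul_sum]
  simp only [single_mul_single, mul_one]
  congr 1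
  exact Fintype.sum_equiv (Equiv.mulLeft (⟨n, hn⟩ : N)) _ _ fun _ => rfl

theorem averageIdem_mul_single (E : Type*) [Field E] [Finite K] (N : Subgroup K) {n : K}
    (hn : n ∈ N) : averageIdem E N * single n 1 = averageIdem E N := by
  have : Fintype N := Fintype.ofFinite N
  rw [averageIdem, smul_mul_assoc, finsum_eq_sum_of_fintype, Finset.sum_mul]
  simp only [single_mul_single, mul_one]
  congr 1
  exact Fintype.sum_equiv (Equiv.mulRight (⟨n, hn⟩ : N)) _ _ fun _ => rfl

theorem neZero_card_subgroup (E : Type*) [Field E] [Finite K] [h : NeZero (Nat.card K : E)]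
    (N : Subgroup K) : (Nat.card N : E) ≠ 0 := by
  obtain ⟨k, hk⟩ := Subgroup.card_subgroup_dvd_card N
  intro h0
  exact h.out (by rw [hk, Nat.cast_mul, h0, zero_mul])

theorem map_averageIdem_eq (E : Type*) [Field E] [Finite K] [NeZero (Nat.card K : E)]
    (N : Subgroup K) {M : Type*} [AddCommGroup M] [Module E M]
    (f : MonoidAlgebra E K →ₗ[E] M) (m : M) (h : ∀ n ∈ N, f (single n 1) = m) :
    f (averageIdem E N) = m := by
  have : Fintype N := Fintype.ofFinite N
  rw [averageIdem, map_smul, finsum_eq_sum_of_fintype, map_sum,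
    Finset.sum_congr rfl fun (n : N) _ => h n n.2, Finset.sum_const, Finset.card_univ,
    ← Nat.card_eq_fintype_card, ← Nat.cast_smul_eq_nsmul E, smul_smul,
    inv_mul_cancel₀ (neZero_card_subgroup E N), one_smul]

theorem averageIdem_mul_eq_self_iff (E : Type*) [Field E] [Finite K] [NeZero (Nat.card K : E)]
    (N : Subgroup K) (a : MonoidAlgebra E K) :
    averageIdem E N * a = a ↔ ∀ n ∈ N, single n 1 * a = a := by
  constructor
  · intro h n hn
    rw [← h, ← mul_assoc, single_mul_averageIdem E N hn]
  · intro h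
    exact map_averageIdem_eq E N (LinearMap.mulRight E a) a h

theorem averageIdem_mem_center (E : Type*) [Field E] [Finite K] (N : Subgroup K) [N.Normal] :
    averageIdem E N ∈ Subalgebra.center E (MonoidAlgebra E K) := by
  have : Fintype N := Fintype.ofFinite N
  rw [mem_center_iff_single]
  intro g
  rw [averageIdem, smul_mul_assoc, mul_smul_comm, finsum_eq_sum_of_fintype, Finset.sum_mul,
    Finset.mul_sum]
  simp only [single_mul_single, mul_one]
  congr 1
  exact Fintype.sum_equiv (MulAut.conjNormal g).toEquiv _ _ fun n => by simp

/-- The average over a normal subgroup, as an element of the centre of the group algebra. -/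
noncomputable def centralIdem (E : Type*) [Field E] [Finite K] (N : Subgroup K) [N.Normal] :
    Subalgebra.center E (MonoidAlgebra E K) :=
  ⟨averageIdem E N, averageIdem_mem_center E N⟩

/-- An automorphism that is trivial modulo `N` is trivial on the part of the group algebra
belonging to `N`. -/
theorem averageIdem_mul_algAut (E : Type*) [Field E] [Finite K]
    (N : Subgroup K) [N.Normal] {φ : MulAut K} (h : ∀ x, φ x * x⁻¹ ∈ N) (a : MonoidAlgebra E K) :
    averageIdem E N * algAut E φ a = averageIdem E N * a := by
  induction a using MonoidAlgebra.induction_linear with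
  | zero => simp
  | add a b ha hb => rw [map_add, mul_add, mul_add, ha, hb]
  | single x c =>
    have : (single (φ x) c : MonoidAlgebra E K) = single (φ x * x⁻¹) 1 * single x c := by
      simp [single_mul_single]
    rw [algAut_single, this, ← mul_assoc, averageIdem_mul_single E N (h x)]

/-- The points of the centre of the group algebra: its central characters over `E`. -/
abbrev CentralCharacter (E K : Type*) [Field E] [Group K] :=
  Subalgebra.center E (MonoidAlgebra E K) →ₐ[E] E

theorem centerMap_algAut_mul (E : Type*) [Field E] (φ ψ : MulAut K)
    (z : Subalgebra.center E (MonoidAlgebra E K)) :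
    centerMap (algAut E (φ * ψ)) z = centerMap (algAut E φ) (centerMap (algAut E ψ) z) := by
  apply Subtype.ext
  simp only [coe_centerMap, algAut, map_mul, AlgEquiv.mul_apply]

theorem centerMap_algAut_one (E : Type*) [Field E]
    (z : Subalgebra.center E (MonoidAlgebra E K)) : centerMap (algAut E (1 : MulAut K)) z = z := by
  apply Subtype.ext
  simp only [coe_centerMap, algAut, map_one, AlgEquiv.one_apply]

/-- The permutation of the central characters induced by an automorphism of the group. -/
noncomputable def centralCharacterPerm (E : Type*) [Field E] (φ : MulAut K) :
    Equiv.Perm (CentralCharacter E K) where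
  toFun l := l.comp (centerMap (algAut E φ))
  invFun l := l.comp (centerMap (algAut E φ⁻¹))
  left_inv l := by
    ext z
    simp only [AlgHom.comp_apply, ← centerMap_algAut_mul, mul_inv_cancel, centerMap_algAut_one]
  right_inv l := by
    ext z
    simp only [AlgHom.comp_apply, ← centerMap_algAut_mul, inv_mul_cancel, centerMap_algAut_one]

/-- Precomposition reverses products, which is harmless for powers of one automorphism. -/
theorem centralCharacterPerm_pow (E : Type*) [Field E] (φ : MulAut K) (d : ℕ) :
    centralCharacterPerm E φ ^ d = centralCharacterPerm E (φ ^ d) := by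
  induction d with
  | zero =>
    ext l z
    exact (congrArg l (centerMap_algAut_one E z)).symm
  | succ d ih =>
    rw [pow_succ, ih]
    ext l z
    change l (centerMap _ (centerMap _ z)) = l (centerMap _ z)
    rw [← centerMap_algAut_mul, pow_succ']

theorem centralCharacterPerm_pow_eq_one (E : Type*) [Field E] {φ : MulAut K} {d : ℕ}
    (h : φ ^ d = 1) : centralCharacterPerm E φ ^ d = 1 := by
  rw [centralCharacterPerm_pow, h, ← pow_zero φ, ← centralCharacterPerm_pow, pow_zero]

/-- Every central character fixed by `φ` is trivial on `N`. -/
def FixedCentralCharactersTrivialOn (E : Type*) [Field E] [Finite K] (φ : MulAut K)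
    (N : Subgroup K) [N.Normal] : Prop :=
  ∀ l : CentralCharacter E K, (∀ z, l (centerMap (algAut E φ) z) = l z) → l (centralIdem E N) = 1

/-- A character with value 1 on the average over N sees only the part of the algebra on which φ is
trivial. -/
theorem fixed_of_centralIdem_eq_one (E : Type*) [Field E] [Finite K] {N : Subgroup K} [N.Normal] {φ : MulAut K}
    (h : ∀ x, φ x * x⁻¹ ∈ N) {l : CentralCharacter E K} (hl : l (centralIdem E N) = 1)
    (z : Subalgebra.center E (MonoidAlgebra E K)) : l (centerMap (algAut E φ) z) = l z := by
  have : centralIdem E N * centerMap (algAut E φ) z = centralIdem E N * z :=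
    Subtype.ext (averageIdem_mul_algAut E N h _)
  have := congrArg l this
  rwa [map_mul, map_mul, hl, one_mul, one_mul] at this

/-- The characters trivial on N are among the fixed ones, so all fixed ones are trivial on N exactly
when the two finite sets have equal size. Numbers, unlike characters, can be compared across fields.
-/
theorem fixedCentralCharactersTrivialOn_iff_card (E : Type*) [Field E] [Finite K]
    [Finite (CentralCharacter E K)] {N : Subgroup K} [N.Normal] {φ : MulAut K}
    (h : ∀ x, φ x * x⁻¹ ∈ N) :
    FixedCentralCharactersTrivialOn E φ N ↔
      Nat.card {l // centralCharacterPerm E φ l = l} =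
        Nat.card {l : CentralCharacter E K // l (centralIdem E N) = 1} := by
  have hfix : ∀ l : CentralCharacter E K, centralCharacterPerm E φ l = l ↔
      ∀ z, l (centerMap (algAut E φ) z) = l z := fun l => DFunLike.ext_iff
  have hsub : {l : CentralCharacter E K | l (centralIdem E N) = 1} ⊆
      {l | centralCharacterPerm E φ l = l} := fun l hl =>
    (hfix l).2 (fixed_of_centralIdem_eq_one E h hl)
  constructor
  · intro H
    exact Nat.card_congr (Equiv.subtypeEquivRight fun l => ⟨fun hl => H l ((hfix l).1 hl),
      fun hl => hsub hl⟩)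
  · intro H l hl
    have := Set.eq_of_subset_of_ncard_le hsub (le_of_eq H)
    have hm : l ∈ {l | centralCharacterPerm E φ l = l} := (hfix l).2 hl
    rw [← this] at hm
    exact hm

/-! ### Counts that do not depend on the field. -/

section Count

variable (E : Type*) [Field E] [IsAlgClosed E] [Finite K] [NeZero (Nat.card K : E)]

theorem bijective_eval_centralCharacter :
    Function.Bijective (LinearMap.pi fun l : CentralCharacter E K => l.toLinearMap) :=
  have : IsReduced (Subalgebra.center E (MonoidAlgebra E K)) := isReduced_center E _
  bijective_eval_algHom E _

/-- Functions on the central characters, as central elements of the group algebra. -/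
noncomputable def ofCentralCharacterFun : (CentralCharacter E K → E) →ₗ[E] MonoidAlgebra E K :=
  (Subalgebra.center E (MonoidAlgebra E K)).val.toLinearMap ∘ₗ
    (LinearEquiv.ofBijective _ (bijective_eval_centralCharacter E)).symm.toLinearMap

theorem ofCentralCharacterFun_injective :
    Function.Injective (ofCentralCharacterFun E (K := K)) :=
  Subtype.val_injective.comp (LinearEquiv.injective _)

theorem ofCentralCharacterFun_apply (z : Subalgebra.center E (MonoidAlgebra E K)) :
    ofCentralCharacterFun E (fun l => l z) = z := by
  change (((LinearEquiv.ofBijective _ (bijective_eval_centralCharacter E)).symm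
    (LinearEquiv.ofBijective _ (bijective_eval_centralCharacter E) z) : _) : MonoidAlgebra E K) = z
  rw [LinearEquiv.symm_apply_apply]

theorem exists_eq_eval (f : CentralCharacter E K → E) : ∃ z, f = fun l => l z :=
  (bijective_eval_centralCharacter E).2 f |>.imp fun _ h => h.symm

theorem eq_of_eval_eq {z w : Subalgebra.center E (MonoidAlgebra E K)}
    (h : ∀ l : CentralCharacter E K, l z = l w) : z = w :=
  (bijective_eval_centralCharacter E).1 (funext h)

theorem mem_map_center_iff (S : CentralCharacter E K → CentralCharacter E K → Prop)
    (a : MonoidAlgebra E K) :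
    a ∈ (invariantFunctions E S).map (ofCentralCharacterFun E) ↔
      ∃ z : Subalgebra.center E (MonoidAlgebra E K), (∀ l m, S l m → l z = m z) ∧ (z : _) = a := by
  constructor
  · rintro ⟨f, hf, rfl⟩
    obtain ⟨z, rfl⟩ := exists_eq_eval E f
    exact ⟨z, hf, (ofCentralCharacterFun_apply E z).symm⟩
  · rintro ⟨z, hz, rfl⟩
    exact ⟨fun l => l z, hz, ofCentralCharacterFun_apply E z⟩

/-- Both sides are the dimension of the subspace of the centre fixed by φ^d, in the coordinates
given by central characters and by group elements. The right side does not mention E. -/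
theorem card_orbits_centralCharacterPerm (φ : MulAut K) (d : ℕ) :
    Nat.card (Quot fun l m => (centralCharacterPerm E φ ^ d) l = m) =
      Nat.card (Quot fun x y : K => IsConj x y ∨ (φ ^ d) x = y) := by
  rw [centralCharacterPerm_pow]
  generalize φ ^ d = φ
  refine card_quot_eq_of_map_eq (ofCentralCharacterFun E) (groupFun E)
    (ofCentralCharacterFun_injective E) (groupFun_injective E) ?_
  ext a
  rw [mem_map_center_iff, mem_map_groupFun_iff]
  constructor
  · rintro ⟨z, hz, rfl⟩ x y (h | rfl)
    · exact (mem_center_iff_coeff E _).1 z.2 x y h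
    · have : centerMap (algAut E φ) z = z := eq_of_eval_eq E fun l => (hz l _ rfl).symm
      rw [← coeff_algAut E φ (z : MonoidAlgebra E K) x, ← coe_centerMap, this]
  · intro h
    refine ⟨⟨a, (mem_center_iff_coeff E _).2 fun x y hxy => h x y (Or.inl hxy)⟩, ?_, rfl⟩
    rintro l _ rfl
    refine congrArg l (Subtype.ext ?_)
    change a = algAut E φ a
    ext x
    obtain ⟨x, rfl⟩ := φ.surjective x
    rw [coeff_algAut]
    exact (h x _ (Or.inr rfl)).symm

/-- With ê the average over N, both sides are the dimension of the space of central z with ê z = z: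
the functions supported on the characters with value 1 at ê, or the class functions constant on
cosets of N. -/
theorem card_centralCharacter_trivialOn (N : Subgroup K) [N.Normal] :
    Nat.card {l : CentralCharacter E K // l (centralIdem E N) = 1} =
      Nat.card (Quot fun x y : K => IsConj x y ∨ x * y⁻¹ ∈ N) := by
  classical
  have : Fintype {l : CentralCharacter E K // l (centralIdem E N) = 1} := Fintype.ofFinite _
  let g : ({l : CentralCharacter E K // l (centralIdem E N) = 1} → E) →ₗ[E] MonoidAlgebra E K :=
    ofCentralCharacterFun E ∘ₗ Function.ExtendByZero.linearMap E Subtype.val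
  have hg : Function.Injective g := (ofCentralCharacterFun_injective E).comp fun u v h =>
    funext fun l => by
      have := congrFun h l.1
      simpa [Subtype.val_injective.extend_apply] using this
  rw [← finrank_invariantFunctions E, ← Submodule.finrank_map_of_injective _ (groupFun_injective E),
    Nat.card_eq_fintype_card, ← Module.finrank_fintype_fun_eq_card E,
    ← LinearMap.finrank_range_of_inj hg]
  have hrange : ∀ a, a ∈ LinearMap.range g ↔
      ∃ z : Subalgebra.center E (MonoidAlgebra E K), centralIdem E N * z = z ∧ (z : _) = a := by
    intro a
    constructor
    · rintro ⟨f, rfl⟩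
      obtain ⟨z, hz⟩ := exists_eq_eval E (Function.ExtendByZero.linearMap E Subtype.val f)
      refine ⟨z, eq_of_eval_eq E fun l => ?_, ?_⟩
      · by_cases hl : l (centralIdem E N) = 1
        · rw [map_mul, hl, one_mul]
        · have : l z = 0 := by
            rw [← congrFun hz l]
            refine Function.extend_apply' _ _ _ ?_
            rintro ⟨m, rfl⟩
            exact hl m.2
          rw [map_mul, this, mul_zero]
      · change _ = ofCentralCharacterFun E (Function.ExtendByZero.linearMap E Subtype.val f)
        rw [hz, ofCentralCharacterFun_apply]
    · rintro ⟨z, hz, rfl⟩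
      refine ⟨fun l => l.1 z, ?_⟩
      rw [← ofCentralCharacterFun_apply]
      refine congrArg (ofCentralCharacterFun E) (funext fun l => ?_)
      by_cases hl : l (centralIdem E N) = 1
      · rw [Function.ExtendByZero.linearMap_apply]
        exact Subtype.val_injective.extend_apply _ _ (⟨l, hl⟩ : {l : CentralCharacter E K //
          l (centralIdem E N) = 1})
      · have h0 : l z = 0 := by
          have := congrArg l hz
          rw [map_mul] at this
          by_contra h
          exact hl (mul_right_cancel₀ h (this.trans (one_mul _).symm))
        rw [h0]
        rw [Function.ExtendByZero.linearMap_apply]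
        refine Function.extend_apply' _ _ _ ?_
        rintro ⟨m, rfl⟩
        exact hl m.2
  suffices h : LinearMap.range g = (invariantFunctions E fun x y => IsConj x y ∨
      x * y⁻¹ ∈ N).map (groupFun E) by rw [h]
  refine Submodule.ext fun a => ?_
  rw [hrange, mem_map_groupFun_iff]
  constructor
  · rintro ⟨z, hz, rfl⟩ x y (h | h)
    · exact (mem_center_iff_coeff E _).1 z.2 x y h
    · have h1 := (averageIdem_mul_eq_self_iff E N _).1 (congrArg Subtype.val hz) _ h
      conv_lhs => rw [← h1, coeff_single_mul_apply]
      simp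
  · intro h
    refine ⟨⟨a, (mem_center_iff_coeff E _).2 fun x y hxy => h x y (Or.inl hxy)⟩, ?_, rfl⟩
    refine Subtype.ext ((averageIdem_mul_eq_self_iff E N _).2 fun n hn => ?_)
    ext x
    rw [coeff_single_mul_apply, one_mul]
    exact h _ _ (Or.inr (by simpa using hn))

end Count

/-- Whether the central characters fixed by an automorphism of `p`-power order are trivial on `N`
does not depend on the algebraically closed field. -/
theorem fixedCentralCharactersTrivialOn_congr (E E' : Type*) [Field E] [IsAlgClosed E] [Field E']
    [IsAlgClosed E'] [Finite K] [NeZero (Nat.card K : E)] [NeZero (Nat.card K : E')]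
    {p a : ℕ} [Fact p.Prime] {φ : MulAut K} (hφ : φ ^ p ^ a = 1) {N : Subgroup K} [N.Normal]
    (h : ∀ x, φ x * x⁻¹ ∈ N) :
    FixedCentralCharactersTrivialOn E φ N ↔ FixedCentralCharactersTrivialOn E' φ N := by
  have hcard := card_fixed_eq_of_card_orbits_eq (centralCharacterPerm E φ)
    (centralCharacterPerm E' φ) (centralCharacterPerm_pow_eq_one E hφ)
    (centralCharacterPerm_pow_eq_one E' hφ) fun d => by
      rw [card_orbits_centralCharacterPerm, card_orbits_centralCharacterPerm]
  rw [fixedCentralCharactersTrivialOn_iff_card E h, fixedCentralCharactersTrivialOn_iff_card E' h,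
    hcard, card_centralCharacter_trivialOn, card_centralCharacter_trivialOn]

end GroupAlgebra

/-! ### Central characters and irreducible representations. -/

/-- The smallest normal subgroup modulo which an automorphism is trivial. -/
def autCommutator {K : Type*} [Group K] (φ : MulAut K) : Subgroup K :=
  Subgroup.normalClosure (Set.range fun x => φ x * x⁻¹)

instance {K : Type*} [Group K] (φ : MulAut K) : (autCommutator φ).Normal :=
  Subgroup.normalClosure_normal

theorem mul_inv_mem_autCommutator {K : Type*} [Group K] (φ : MulAut K) (x : K) :
    φ x * x⁻¹ ∈ autCommutator φ :=
  Subgroup.subset_normalClosure ⟨x, rfl⟩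

theorem autCommutator_le_iff {K : Type*} [Group K] (φ : MulAut K) (N : Subgroup K) [N.Normal] :
    autCommutator φ ≤ N ↔ ∀ x, φ x * x⁻¹ ∈ N :=
  ⟨fun h x => h (mul_inv_mem_autCommutator φ x),
    fun h => Subgroup.normalClosure_le_normal (Set.range_subset_iff.2 h)⟩

section CentralCharacterOfRepresentation

open MonoidAlgebra

theorem nontrivial_of_isIrreducible {E K V : Type*} [Field E] [Group K] [AddCommGroup V]
    [Module E V] (ρ : Representation E K V) [ρ.IsIrreducible] : Nontrivial V := by
  by_contra h
  rw [not_nontrivial_iff_subsingleton] at h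
  obtain ⟨x, y, hxy⟩ := exists_pair_ne (Subrepresentation ρ)
  exact hxy (Subrepresentation.toSubmodule_injective (Subsingleton.elim _ _))

theorem Representation.asAlgebraHom_single_mul {E K V : Type*} [Field E] [Group K]
    [AddCommGroup V] [Module E V] (ρ : Representation E K V) (x : K)
    (a : MonoidAlgebra E K) : ρ.asAlgebraHom (single x 1 * a) = ρ x * ρ.asAlgebraHom a := by
  rw [map_mul, Representation.asAlgebraHom_single_one]

/-- The average over N acts as the scalar l(ê), and absorbs multiplication by elements of N. -/
theorem centralCharacter_centralIdem_eq_one_iff {E K V : Type*} [Field E] [Group K]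
    [AddCommGroup V] [Module E V] [Finite K] [NeZero (Nat.card K : E)] [Nontrivial V]
    {ρ : Representation E K V} {l : CentralCharacter E K}
    (hl : ∀ z : Subalgebra.center E (MonoidAlgebra E K),
      ρ.asAlgebraHom z = algebraMap E (Module.End E V) (l z)) (N : Subgroup K) [N.Normal] :
    l (centralIdem E N) = 1 ↔ ∀ n ∈ N, ρ n = 1 := by
  have key := hl (centralIdem E N)
  constructor
  · intro h n hn
    rw [h, map_one] at key
    have h2 := ρ.asAlgebraHom_single_mul n (averageIdem E N)
    rw [single_mul_averageIdem E N hn] at h2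
    change ρ.asAlgebraHom (averageIdem E N) = 1 at key
    rwa [key, mul_one, eq_comm] at h2
  · intro h
    refine FaithfulSMul.algebraMap_injective E (Module.End E V) ?_
    rw [← key, map_one]
    exact map_averageIdem_eq E N ρ.asAlgebraHom.toLinearMap 1 fun n hn => by
      simp [h n hn]

/-- The trace of a central z is dim V times l(z), and dim V is invertible in characteristic zero.
Sums of conjugates recover the character from l. -/
theorem centralCharacter_fixed_iff {E K V : Type*} [Field E] [Group K] [AddCommGroup V] [Module E V]
    [FiniteDimensional E V] [CharZero E] [Finite K] [Nontrivial V]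
    {ρ : Representation E K V} {l : CentralCharacter E K}
    (hl : ∀ z : Subalgebra.center E (MonoidAlgebra E K),
      ρ.asAlgebraHom z = algebraMap E (Module.End E V) (l z)) (φ : MulAut K) :
    (∀ z, l (centerMap (algAut E φ) z) = l z) ↔ ∀ x, ρ.character (φ x) = ρ.character x := by
  let T : MonoidAlgebra E K →ₗ[E] E := LinearMap.trace E V ∘ₗ ρ.asAlgebraHom.toLinearMap
  have hT : ∀ x, T (single x 1) = ρ.character x := fun x => by
    simp [T, Representation.character]
  have hTz : ∀ z : Subalgebra.center E (MonoidAlgebra E K), T z = Module.finrank E V * l z :=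
    fun z => by
      change LinearMap.trace E V (ρ.asAlgebraHom z) = _
      rw [hl, Algebra.algebraMap_eq_smul_one, map_smul, LinearMap.trace_one, smul_eq_mul, mul_comm]
  have hn : (Module.finrank E V : E) ≠ 0 := Nat.cast_ne_zero.2 Module.finrank_pos.ne'
  constructor
  · intro h x
    have : Fintype K := Fintype.ofFinite K
    let a : K → MonoidAlgebra E K := fun x => ∑ g : K, single (g * x * g⁻¹) 1
    have ha : ∀ x, a x ∈ Subalgebra.center E (MonoidAlgebra E K) := by
      intro x
      rw [mem_center_iff_single]
      intro g
      simp only [a, Finset.mul_sum, Finset.sum_mul, single_mul_single, mul_one]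
      refine Fintype.sum_equiv (Equiv.mulLeft g) _ _ fun k => ?_
      congr 1
      simp only [Equiv.coe_mulLeft]
      group
    have hTa : ∀ x, T (a x) = Fintype.card K * ρ.character x := by
      intro x
      simp only [a, map_sum, hT, Representation.char_conj, Finset.sum_const, Finset.card_univ,
        nsmul_eq_mul]
    have h1 : (centerMap (algAut E φ) ⟨a x, ha x⟩) = ⟨a (φ x), ha (φ x)⟩ := by
      refine Subtype.ext ?_
      change algAut E φ (a x) = a (φ x)
      simp only [a, map_sum, algAut_single, map_mul, map_inv]
      exact Fintype.sum_equiv φ.toEquiv _ _ fun k => rfl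
    have h2 := h ⟨a x, ha x⟩
    rw [h1] at h2
    have h3 := hTz ⟨a (φ x), ha (φ x)⟩
    rw [h2, ← hTz] at h3
    change T (a (φ x)) = T (a x) at h3
    rw [hTa, hTa] at h3
    exact mul_left_cancel₀ (Nat.cast_ne_zero.2 Fintype.card_ne_zero) h3
  · intro h z
    have hTφ : T ∘ₗ (algAut E φ).toLinearMap = T := by
      refine MonoidAlgebra.lhom_ext' fun x => LinearMap.ext_ring ?_
      change T (algAut E φ (single x 1)) = T (single x 1)
      rw [algAut_single, hT, hT, h]
    refine mul_left_cancel₀ hn ?_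
    rw [← hTz, ← hTz]
    exact DFunLike.congr_fun hTφ (z : MonoidAlgebra E K)

variable {E K V : Type*} [Field E] [IsAlgClosed E] [Group K] [AddCommGroup V] [Module E V]
  [FiniteDimensional E V]

/-- Schur's lemma: central elements act as intertwining maps, hence as scalars. -/
theorem exists_centralCharacter (ρ : Representation E K V) [ρ.IsIrreducible] :
    ∃ l : CentralCharacter E K, ∀ z : Subalgebra.center E (MonoidAlgebra E K),
      ρ.asAlgebraHom z = algebraMap E (Module.End E V) (l z) := by
  have : Nontrivial V := nontrivial_of_isIrreducible ρ
  let f := ρ.asAlgebraHom.comp (Subalgebra.center E (MonoidAlgebra E K)).val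
  have hf : ∀ z, f z ∈ (Algebra.ofId E (Module.End E V)).range := by
    intro z
    let F : Representation.IntertwiningMap ρ ρ := ⟨f z, fun g => by
      have h := Subalgebra.mem_center_iff.1 z.2 (single g 1)
      have h2 := congrArg ρ.asAlgebraHom h
      rw [map_mul, map_mul, Representation.asAlgebraHom_single_one] at h2
      exact h2.symm⟩
    obtain ⟨c, hc⟩ :=
      (Representation.IsIrreducible.algebraMap_intertwiningMap_bijective_of_isAlgClosed
        (ρ := ρ)).2 F
    refine ⟨c, ?_⟩
    have := congrArg (fun G : Representation.IntertwiningMap ρ ρ => G.toLinearMap) hc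
    exact this
  let e := AlgEquiv.ofInjective (Algebra.ofId E (Module.End E V))
    (FaithfulSMul.algebraMap_injective E _)
  refine ⟨(e.symm : _ →ₐ[E] E).comp (f.codRestrict _ hf), fun z => ?_⟩
  exact (congrArg Subtype.val (e.apply_symm_apply (f.codRestrict _ hf z))).symm

theorem exists_representation_of_centralCharacter [Finite K] [NeZero (Nat.card K : E)]
    (l : CentralCharacter E K) :
    ∃ (n : ℕ) (ρ : Representation E K (Fin n → E)), ρ.IsIrreducible ∧
      ∀ z : Subalgebra.center E (MonoidAlgebra E K),
        ρ.asAlgebraHom z = algebraMap E (Module.End E (Fin n → E)) (l z) := by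
  classical
  let A := MonoidAlgebra E K
  obtain ⟨ζ, hζ⟩ := exists_eq_eval E (Pi.single l (1 : E))
  have hζ0 : ζ ≠ 0 := by
    rintro rfl
    have := congrFun hζ l
    simp at this
  -- With ζ the idempotent of l, any simple quotient by a maximal left ideal containing the
  -- annihilator of ζ affords l: z - l(z) kills ζ, so it maps A into this annihilator.
  let L₀ : Submodule A A := LinearMap.ker (LinearMap.toSpanSingleton A A (ζ : A))
  have hL₀ : ∀ a : A, a ∈ L₀ ↔ a * (ζ : A) = 0 := fun a => Iff.rfl
  have hne : L₀ ≠ ⊤ := by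
    intro h
    have h1 : (1 : A) ∈ L₀ := h ▸ Submodule.mem_top
    rw [hL₀, one_mul] at h1
    exact hζ0 (Subtype.ext h1)
  obtain ⟨M, hM, hle⟩ := Ideal.exists_le_maximal L₀ hne
  have hsimple : IsSimpleModule A (A ⧸ M) := isSimpleModule_iff_isCoatom.2 hM.out
  let V := A ⧸ M
  let e : V ≃ₗ[E] (Fin (Module.finrank E V) → E) := (Module.finBasis E V).equivFun
  let ρV : Representation E K V :=
    ((Algebra.lsmul E E V : A →ₐ[E] Module.End E V) : A →* Module.End E V).comp (of E K)
  let ρ : Representation E K (Fin (Module.finrank E V) → E) :=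
    (e.conjAlgEquiv E : Module.End E V →* _).comp ρV
  have hρ : ∀ g v, ρ g v = e ((single g 1 : A) • e.symm v) := fun g v => rfl
  have hρA : ∀ (a : A) v, ρ.asAlgebraHom a v = e (a • e.symm v) := by
    intro a v
    induction a using MonoidAlgebra.induction_linear with
    | zero => simp
    | add a b ha hb => simp only [map_add, LinearMap.add_apply, ha, hb, add_smul]
    | single g c =>
      rw [Representation.asAlgebraHom_single, LinearMap.smul_apply, hρ, ← map_smul]
      have : (single g c : A) = c • single g 1 := by simp
      rw [this, smul_assoc]
  refine ⟨_, ρ, ?_, fun z => ?_⟩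
  · have hnt : Nontrivial V := IsSimpleModule.nontrivial A V
    have : Nontrivial (Fin (Module.finrank E V) → E) := e.symm.toEquiv.nontrivial
    have : Nontrivial (Subrepresentation ρ) := ⟨⊥, ⊤, fun h => by
      have := congrArg Subrepresentation.toSubmodule h
      exact bot_ne_top (α := Submodule E (Fin (Module.finrank E V) → E)) this⟩
    refine ⟨fun W => ?_⟩
    let W' : Submodule A V :=
      { carrier := {v | e v ∈ W.toSubmodule}
        add_mem' := fun {a b} ha hb => by
          simp only [Set.mem_ofPred_eq, map_add] at *
          exact add_mem ha hb
        zero_mem' := by simp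
        smul_mem' := fun a v hv => by
          have h : e (a • v) = ρ.asAlgebraHom a (e v) := by rw [hρA, e.symm_apply_apply]
          change e (a • v) ∈ W.toSubmodule
          rw [h]
          exact (Subrepresentation.asSubmodule W).smul_mem a hv }
    have hW' : ∀ v, v ∈ W.toSubmodule ↔ e.symm v ∈ W' := fun v => by
      change _ ↔ e (e.symm v) ∈ W.toSubmodule
      rw [e.apply_symm_apply]
    rcases eq_bot_or_eq_top W' with h | h
    · left
      refine Subrepresentation.toSubmodule_injective (Submodule.ext fun v => ?_)
      rw [hW', h]
      change _ ↔ v ∈ (⊥ : Submodule E _)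
      simp
    · right
      refine Subrepresentation.toSubmodule_injective (Submodule.ext fun v => ?_)
      rw [hW', h]
      exact ⟨fun _ => Submodule.mem_top (R := E), fun _ => Submodule.mem_top⟩
  · refine LinearMap.ext fun v => ?_
    rw [hρA, Module.algebraMap_end_apply]
    refine e.symm.injective ?_
    rw [e.symm_apply_apply, map_smul]
    obtain ⟨a, ha⟩ := Submodule.Quotient.mk_surjective M (e.symm v)
    rw [← ha]
    change (Submodule.Quotient.mk ((z : A) * a) : V) = Submodule.Quotient.mk (l z • a)
    rw [Submodule.Quotient.eq]
    refine hle ((hL₀ _).2 ?_)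
    have h1 : (z - algebraMap E _ (l z)) * ζ = 0 := eq_of_eval_eq E fun m => by
      have := congrFun hζ m
      by_cases hm : m = l
      · subst hm; simp
      · rw [Pi.single_eq_of_ne hm] at this
        rw [map_mul, ← this]; simp
    have h2 : ((z : A) - algebraMap E A (l z)) * ζ = 0 := congrArg Subtype.val h1
    have h3 : (z : A) * a - l z • a = a * ((z : A) - algebraMap E A (l z)) := by
      rw [mul_sub, Subalgebra.mem_center_iff.1 z.2 a, ← Algebra.commutes, Algebra.smul_def]
    rw [h3, mul_assoc, h2, mul_zero]

end CentralCharacterOfRepresentation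

/-- Each central character over ℂ comes from an irreducible representation, and conversely.
Fixedness and triviality on a normal subgroup match on both sides, so no bijection is needed. -/
theorem forall_irr_iff_fixedCentralCharactersTrivialOn {G : Type*} [Group G] [Finite G]
    (P K : Subgroup G) [K.Normal] :
    (∀ χ : Irr K, ∀ g ∈ inertiaGroup P K χ.1, ∀ x : K,
        ((MulAut.conjNormal g x : K) : K ⧸ Irr.ker χ) = (x : K ⧸ Irr.ker χ)) ↔
      ∀ g ∈ P, FixedCentralCharactersTrivialOn ℂ (MulAut.conjNormal g : MulAut K)
        (autCommutator (MulAut.conjNormal g : MulAut K)) := by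
  have hmem : ∀ (χ : Irr K) (φ : MulAut K), (∀ x : K, ((φ x : K) : K ⧸ Irr.ker χ) = x) ↔
      autCommutator φ ≤ Irr.ker χ := by
    intro χ φ
    rw [autCommutator_le_iff]
    refine forall_congr' fun x => ?_
    rw [eq_comm, QuotientGroup.eq]
    exact Subgroup.Normal.mem_comm_iff inferInstance
  constructor
  · intro H g hg l hl
    obtain ⟨n, ρ, hρ, hρl⟩ := exists_representation_of_centralCharacter l
    have := nontrivial_of_isIrreducible ρ
    let χ : Irr K := ⟨ρ.character, n, ρ, hρ, rfl⟩
    have h1 := (centralCharacter_fixed_iff hρl _).1 hl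
    have h2 := (hmem χ _).1 (H χ g ⟨hg, h1⟩)
    exact (centralCharacter_centralIdem_eq_one_iff hρl _).2 fun x hx =>
      (character_eq_character_one_iff ρ x).1 (h2 hx)
  · rintro H ⟨χ, n, ρ, hρ, rfl⟩ g ⟨hg, hfix⟩
    have := nontrivial_of_isIrreducible ρ
    obtain ⟨l, hl⟩ := exists_centralCharacter ρ
    have h1 := H g hg l ((centralCharacter_fixed_iff hl _).2 hfix)
    refine (hmem ⟨_, n, ρ, hρ, rfl⟩ _).2 fun x hx => ?_
    exact (character_eq_character_one_iff ρ x).2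
      ((centralCharacter_centralIdem_eq_one_iff hl _).1 h1 x hx)

/-! ### Invariant idempotents, Clifford's theorem and subnormality. -/

section InvariantIdempotents

variable {A : Type*} [Ring A]

/-- Every left ideal of `A` that is stable under `H` is generated by an idempotent that is fixed
by `H`. Equivalently, `A` is semisimple as a module for the skew group ring of `H` over `A`. -/
def HasInvariantIdempotents (H : Subgroup (RingAut A)) : Prop :=
  ∀ L : Ideal A, (∀ f ∈ H, ∀ x ∈ L, f x ∈ L) →
    ∃ e ∈ L, (∀ f ∈ H, f e = e) ∧ ∀ x ∈ L, x * e = x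

/-- The ring of additive endomorphisms of `A` generated by the left multiplications and by `H`. -/
def skewRing (H : Subgroup (RingAut A)) : Subring (AddMonoid.End A) :=
  Subring.closure (Set.range (AddMonoid.End.mulLeft : A → AddMonoid.End A) ∪
    {u | ∃ f ∈ H, u = (f : A →+* A).toAddMonoidHom})

theorem mulLeft_mem_skewRing (H : Subgroup (RingAut A)) (a : A) :
    AddMonoid.End.mulLeft a ∈ skewRing H :=
  Subring.subset_closure (Or.inl ⟨a, rfl⟩)

theorem ringAut_mem_skewRing {H : Subgroup (RingAut A)} {f : RingAut A} (hf : f ∈ H) :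
    ((f : A →+* A).toAddMonoidHom : AddMonoid.End A) ∈ skewRing H :=
  Subring.subset_closure (Or.inr ⟨f, hf, rfl⟩)

/-- A submodule over the skew group ring is a left ideal. -/
def Submodule.toStableIdeal {H : Subgroup (RingAut A)} (W : Submodule (skewRing H) A) : Ideal A where
  carrier := W
  add_mem' := W.add_mem
  zero_mem' := W.zero_mem
  smul_mem' a _ hx := W.smul_mem ⟨_, mulLeft_mem_skewRing H a⟩ hx

theorem Submodule.apply_mem_toStableIdeal {H : Subgroup (RingAut A)}
    (W : Submodule (skewRing H) A) {f : RingAut A} (hf : f ∈ H) {x : A}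
    (hx : x ∈ W.toStableIdeal) : f x ∈ W.toStableIdeal :=
  W.smul_mem ⟨_, ringAut_mem_skewRing hf⟩ hx

/-- A left ideal stable under `H` is a submodule over the skew group ring. -/
def Ideal.toSkewSubmodule {H : Subgroup (RingAut A)} (L : Ideal A)
    (hL : ∀ f ∈ H, ∀ x ∈ L, f x ∈ L) : Submodule (skewRing H) A where
  carrier := L
  add_mem' := L.add_mem
  zero_mem' := L.zero_mem
  smul_mem' := by
    rintro ⟨u, hu⟩ x hx
    change u x ∈ L
    induction hu using Subring.closure_induction generalizing x with
    | mem u hu =>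
      rcases hu with ⟨a, rfl⟩ | ⟨f, hf, rfl⟩
      · exact L.mul_mem_left a hx
      · exact hL f hf x hx
    | zero => exact L.zero_mem
    | one => exact hx
    | add u v _ _ hu hv => exact L.add_mem (hu hx) (hv hx)
    | neg u _ hu => exact L.neg_mem (hu hx)
    | mul u v _ _ hu hv => exact hu (hv hx)

/-- The annihilator {x | x e = 0} of a fixed right identity e is a stable complement. Conversely,
split 1 = e + e' along a stable complement: uniqueness of the splitting makes e fixed. -/
theorem hasInvariantIdempotents_iff (H : Subgroup (RingAut A)) :
    HasInvariantIdempotents H ↔ ComplementedLattice (Submodule (skewRing H) A) := by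
  constructor
  · intro h
    refine ⟨fun W => ?_⟩
    obtain ⟨e, he, hfe, hxe⟩ := h W.toStableIdeal fun f hf x hx => W.apply_mem_toStableIdeal hf hx
    let L : Ideal A := LinearMap.ker (LinearMap.toSpanSingleton A A e)
    have hL : ∀ x, x ∈ L ↔ x * e = 0 := fun x => Iff.rfl
    refine ⟨L.toSkewSubmodule fun f hf x hx => ?_, ?_, ?_⟩
    · rw [hL] at hx ⊢
      rw [← hfe f hf, ← map_mul, hx, map_zero]
    · rw [Submodule.disjoint_def]
      intro x hx hx'
      rw [← hxe x hx]
      exact hx'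
    · rw [codisjoint_iff, eq_top_iff]
      intro x _
      rw [Submodule.mem_sup]
      refine ⟨x * e, W.toStableIdeal.mul_mem_left x he, x - x * e, ?_, by abel⟩
      change (x - x * e) * e = 0
      rw [sub_mul, mul_assoc, hxe e he, sub_self]
  · intro h L hL
    obtain ⟨W, hW⟩ := h.exists_isCompl (L.toSkewSubmodule hL)
    obtain ⟨e, he, e', he', hee⟩ := Submodule.mem_sup.1
      (hW.sup_eq_top ▸ Submodule.mem_top : (1 : A) ∈ L.toSkewSubmodule hL ⊔ W)
    have hd := Submodule.disjoint_def.1 hW.disjoint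
    refine ⟨e, he, fun f hf => ?_, fun x hx => ?_⟩
    · have h1 : f e + f e' = e + e' := by rw [← map_add, hee, map_one]
      have h2 : f e - e = e' - f e' := by
        rw [sub_eq_sub_iff_add_eq_add, h1, add_comm]
      refine sub_eq_zero.1 (hd _ (L.sub_mem (hL f hf e he) he) ?_)
      rw [h2]
      exact W.sub_mem he' (W.apply_mem_toStableIdeal hf he')
    · have h1 : x * e' = x - x * e := by
        rw [eq_sub_iff_add_eq, ← mul_add, add_comm e', hee, mul_one]
      have h2 : x * e' = 0 := by
        refine hd _ ?_ (W.toStableIdeal.mul_mem_left x he')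
        rw [h1]
        exact L.sub_mem hx (L.mul_mem_left x he)
      rw [h2] at h1
      exact (sub_eq_zero.1 h1.symm).symm

/-- An automorphism normalizing `H` permutes the left ideals stable under `H`. -/
def Submodule.skewMap {H : Subgroup (RingAut A)} {f : RingAut A}
    (hf : f ∈ Subgroup.normalizer (H : Set (RingAut A))) (W : Submodule (skewRing H) A) :
    Submodule (skewRing H) A :=
  (W.toStableIdeal.comap (f⁻¹ : RingAut A)).toSkewSubmodule fun g hg x hx => by
    rw [Ideal.mem_comap] at hx ⊢
    have h1 : f⁻¹ * g * f ∈ H := (Subgroup.mem_normalizer_iff''.1 hf g).1 hg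
    have h2 := W.apply_mem_toStableIdeal h1 hx
    simpa [RingAut.mul_apply] using h2

theorem Submodule.mem_skewMap {H : Subgroup (RingAut A)} {f : RingAut A}
    (hf : f ∈ Subgroup.normalizer (H : Set (RingAut A))) (W : Submodule (skewRing H) A) (x : A) :
    x ∈ W.skewMap hf ↔ f⁻¹ x ∈ W := Iff.rfl

/-- The action of the normalizer on the lattice of stable left ideals. -/
def skewOrderIso {H : Subgroup (RingAut A)} {f : RingAut A}
    (hf : f ∈ Subgroup.normalizer (H : Set (RingAut A))) :
    Submodule (skewRing H) A ≃o Submodule (skewRing H) A where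
  toFun W := W.skewMap hf
  invFun W := W.skewMap (inv_mem hf)
  left_inv W := by
    ext x
    simp only [Submodule.mem_skewMap, ← RingAut.mul_apply, inv_mul_cancel, inv_inv,
      RingAut.one_apply]
  right_inv W := by
    ext x
    simp only [Submodule.mem_skewMap, ← RingAut.mul_apply, inv_inv, mul_inv_cancel,
      RingAut.one_apply]
  map_rel_iff' {W W'} := by
    refine ⟨fun h x hx => ?_, fun h x hx => h hx⟩
    have : f x ∈ W.skewMap hf := by
      rw [Submodule.mem_skewMap, ← RingAut.mul_apply, inv_mul_cancel]; exact hx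
    have h2 := h this
    change f x ∈ W'.skewMap hf at h2
    rwa [Submodule.mem_skewMap, ← RingAut.mul_apply, inv_mul_cancel] at h2

theorem isAtomic_skewSubmodule [IsArtinianRing A] (H : Subgroup (RingAut A)) :
    IsAtomic (Submodule (skewRing H) A) := by
  have : WellFoundedLT (Submodule (skewRing H) A) :=
    StrictMono.wellFoundedLT (f := Submodule.toStableIdeal) fun W W' h => h
  infer_instance

theorem Submodule.mem_toStableIdeal {H : Subgroup (RingAut A)} (W : Submodule (skewRing H) A)
    {x : A} : x ∈ W.toStableIdeal ↔ x ∈ W := Iff.rfl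

theorem Ideal.mem_toSkewSubmodule {H : Subgroup (RingAut A)} {L : Ideal A}
    (hL : ∀ f ∈ H, ∀ x ∈ L, f x ∈ L) {x : A} : x ∈ L.toSkewSubmodule hL ↔ x ∈ L := Iff.rfl

theorem mem_skewOrderIso {H : Subgroup (RingAut A)} {f : RingAut A}
    (hf : f ∈ Subgroup.normalizer (H : Set (RingAut A))) (W : Submodule (skewRing H) A) (x : A) :
    x ∈ skewOrderIso hf W ↔ f⁻¹ x ∈ W := Iff.rfl

theorem skewOrderIso_sSup_atoms_le {H : Subgroup (RingAut A)} {f : RingAut A}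
    (hf : f ∈ Subgroup.normalizer (H : Set (RingAut A))) :
    skewOrderIso hf (sSup {W | IsAtom W}) ≤ sSup {W | IsAtom W} := by
  rw [OrderIso.map_sSup]
  exact iSup₂_le fun W hW => le_sSup (((skewOrderIso hf).isAtom_iff W).2 hW)

theorem apply_mem_sSup_atoms {H : Subgroup (RingAut A)} {f : RingAut A}
    (hf : f ∈ Subgroup.normalizer (H : Set (RingAut A))) {x : A}
    (hx : x ∈ sSup {W : Submodule (skewRing H) A | IsAtom W}) :
    f x ∈ sSup {W : Submodule (skewRing H) A | IsAtom W} := by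
  refine skewOrderIso_sSup_atoms_le hf ?_
  rw [mem_skewOrderIso, ← RingAut.mul_apply, inv_mul_cancel]
  exact hx

/-- Clifford's theorem: semisimplicity is inherited by normal subgroups. -/
theorem HasInvariantIdempotents.of_le_normalizer [IsArtinianRing A] {H N : Subgroup (RingAut A)}
    (hHN : H ≤ N) (hN : N ≤ Subgroup.normalizer (H : Set (RingAut A)))
    (h : HasInvariantIdempotents N) : HasInvariantIdempotents H := by
  rw [hasInvariantIdempotents_iff] at h ⊢
  have := isAtomic_skewSubmodule H
  refine complementedLattice_of_sSup_atoms_eq_top ?_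
  -- T is the socle for H. It is stable under N, which permutes the minimal stable ideals, so it has
  -- an N-stable complement C; a nonzero C would contain an atom.
  generalize hT : sSup {W : Submodule (skewRing H) A | IsAtom W} = T
  have hstable : ∀ f ∈ N, ∀ x ∈ T.toStableIdeal, f x ∈ T.toStableIdeal := by
    intro f hf x hx
    rw [Submodule.mem_toStableIdeal, ← hT] at hx ⊢
    exact apply_mem_sSup_atoms (hN hf) hx
  obtain ⟨C, hC⟩ := h.exists_isCompl (T.toStableIdeal.toSkewSubmodule hstable)
  have hstC : ∀ f ∈ H, ∀ x ∈ C.toStableIdeal, f x ∈ C.toStableIdeal := fun f hf x hx =>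
    C.apply_mem_toStableIdeal (hHN hf) hx
  have hd := Submodule.disjoint_def.1 hC.disjoint
  have hC' : C.toStableIdeal.toSkewSubmodule hstC = ⊥ := by
    rcases eq_bot_or_exists_atom_le (C.toStableIdeal.toSkewSubmodule hstC) with h0 | ⟨W, hW, hle⟩
    · exact h0
    · refine absurd ?_ hW.1
      rw [eq_bot_iff]
      intro x hx
      have h1 : W ≤ T := hT ▸ le_sSup hW
      have h2 := (Ideal.mem_toSkewSubmodule hstC).1 (hle hx)
      rw [Submodule.mem_toStableIdeal] at h2
      rw [Submodule.mem_bot]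
      exact hd x ((Ideal.mem_toSkewSubmodule hstable).2 (T.mem_toStableIdeal.2 (h1 hx))) h2
  rw [eq_top_iff]
  intro x _
  have hx : x ∈ T.toStableIdeal.toSkewSubmodule hstable ⊔ C := by
    rw [hC.sup_eq_top]; exact Submodule.mem_top
  obtain ⟨t, ht, c, hc, rfl⟩ := Submodule.mem_sup.1 hx
  have hc0 : c ∈ C.toStableIdeal.toSkewSubmodule hstC :=
    (Ideal.mem_toSkewSubmodule hstC).2 (C.mem_toStableIdeal.2 hc)
  rw [hC', Submodule.mem_bot] at hc0
  rw [hc0, add_zero]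
  exact T.mem_toStableIdeal.1 ((Ideal.mem_toSkewSubmodule hstable).1 ht)

end InvariantIdempotents

/-- A property of subgroups of a `p`-group that passes to normal subgroups passes to all
subgroups. -/
theorem IsPGroup.induction_normal {Γ : Type*} [Group Γ] {p : ℕ} [Fact p.Prime] {Q : Subgroup Γ}
    [Finite Q] (hQ : IsPGroup p Q) {C : Subgroup Γ → Prop} (hC : C Q)
    (step : ∀ H N : Subgroup Γ, H ≤ N → N ≤ Subgroup.normalizer (H : Set Γ) → C N → C H)
    {H : Subgroup Γ} (hH : H ≤ Q) : C H := by
  -- Proper subgroups of a finite p-group are strictly smaller than their normalizers, so passing to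
  -- the normalizer lowers the index.
  have hnc : NormalizerCondition Q := by
    have := hQ.isNilpotent
    exact Group.normalizerCondition_of_isNilpotent
  have key : ∀ (n : ℕ) (U : Subgroup Q), U.index ≤ n → C (U.map Q.subtype) := by
    intro n
    induction n with
    | zero =>
      intro U hU
      exact absurd (Nat.le_zero.1 hU) U.index_ne_zero_of_finite
    | succ n ih =>
      intro U hU
      by_cases htop : U = ⊤
      · rw [htop, ← MonoidHom.range_eq_map, Subgroup.range_subtype]
        exact hC
      · have hlt := hnc U (lt_top_iff_ne_top.2 htop)
        refine step _ ((Subgroup.normalizer (U : Set Q)).map Q.subtype)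
          (Subgroup.map_mono hlt.le) ?_ (ih _ ?_)
        · exact Subgroup.le_normalizer_map _
        · have := Subgroup.index_strictAnti hlt
          omega
  have := key _ (H.subgroupOf Q) le_rfl
  rwa [Subgroup.map_subgroupOf_eq_of_le hH] at this

/-! ### Descent of scalars and construction of invariant idempotents. -/

section GroupAlgebra

open MonoidAlgebra

variable {K : Type*} [Group K]

theorem algAut_mul (E : Type*) [Field E] (φ ψ : MulAut K) (a : MonoidAlgebra E K) :
    algAut E (φ * ψ) a = algAut E φ (algAut E ψ a) := by
  rw [algAut, map_mul, AlgEquiv.mul_apply]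

theorem exists_mul_eq_self_of_isCompl {A : Type*} [Ring A] {L M : Ideal A} (h : IsCompl L M) :
    ∃ e ∈ L, ∀ x ∈ L, x * e = x := by
  obtain ⟨e, he, e', he', hee⟩ := Submodule.mem_sup.1
    (h.sup_eq_top ▸ Submodule.mem_top : (1 : A) ∈ L ⊔ M)
  refine ⟨e, he, fun x hx => ?_⟩
  have h1 : x * e' = x - x * e := by
    rw [eq_sub_iff_add_eq, ← mul_add, add_comm e', hee, mul_one]
  have h2 : x * e' = 0 := Submodule.disjoint_def.1 h.disjoint _
    (by rw [h1]; exact L.sub_mem hx (L.mul_mem_left x he)) (M.mul_mem_left x he')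
  rw [h2] at h1
  exact (sub_eq_zero.1 h1.symm).symm

/-- Automorphisms of a group as automorphisms of its group algebra. -/
noncomputable def ringAutHom (E K : Type*) [Field E] [Group K] :
    MulAut K →* RingAut (MonoidAlgebra E K) where
  toFun φ := (algAut E φ).toRingEquiv
  map_one' := by
    refine RingEquiv.ext fun a => ?_
    change algAut E 1 a = a
    rw [algAut, map_one, AlgEquiv.one_apply]
  map_mul' φ ψ := RingEquiv.ext fun a => algAut_mul E φ ψ a

theorem ringAutHom_apply (E : Type*) [Field E] (φ : MulAut K) (a : MonoidAlgebra E K) :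
    ringAutHom E K φ a = algAut E φ a := rfl

theorem hasInvariantIdempotents_map_iff (E : Type*) [Field E] (Q : Subgroup (MulAut K)) :
    HasInvariantIdempotents (Q.map (ringAutHom E K)) ↔
      ∀ L : Ideal (MonoidAlgebra E K), (∀ φ ∈ Q, ∀ x ∈ L, algAut E φ x ∈ L) →
        ∃ e ∈ L, (∀ φ ∈ Q, algAut E φ e = e) ∧ ∀ x ∈ L, x * e = x := by
  simp only [HasInvariantIdempotents, Subgroup.mem_map, forall_exists_index, and_imp,
    forall_apply_eq_imp_iff₂, ringAutHom_apply]

section Descent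

variable {E E' : Type*} [Field E] [Field E'] [Algebra E E']

/-- Extension of scalars of group algebras. -/
noncomputable abbrev baseChange (E E' K : Type*) [Field E] [Field E'] [Algebra E E'] [Group K] :
    MonoidAlgebra E K →+* MonoidAlgebra E' K :=
  mapRingHom K (algebraMap E E')

theorem baseChange_single (x : K) (c : E) :
    baseChange E E' K (single x c) = single x (algebraMap E E' c) := by simp

theorem baseChange_algAut (φ : MulAut K) (a : MonoidAlgebra E K) :
    baseChange E E' K (algAut E φ a) = algAut E' φ (baseChange E E' K a) := by
  induction a using MonoidAlgebra.induction_linear with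
  | zero => simp
  | add a b ha hb => simp only [map_add, ha, hb]
  | single x c => simp only [algAut_single, baseChange_single]

/-- A linear map applied to all coefficients of an element of a group algebra. -/
noncomputable def coeffMap (K : Type*) (r : E' →ₗ[E] E) :
    MonoidAlgebra E' K →+ MonoidAlgebra E K where
  toFun a := .ofCoeff (a.coeff.mapRange r (map_zero r))
  map_zero' := by ext; simp
  map_add' a b := by ext; simp

theorem coeffMap_single {α : Type*} (r : E' →ₗ[E] E) (x : α) (c : E') :
    coeffMap α r (single x c) = single x (r c) :=
  congrArg ofCoeff Finsupp.mapRange_single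

/-- An E-linear r is not multiplicative, but on coefficients it is linear for multiplication by EK
on either side; descent needs no more. -/
theorem coeffMap_mul_baseChange (r : E' →ₗ[E] E) (a : MonoidAlgebra E' K) (b : MonoidAlgebra E K) :
    coeffMap K r (a * baseChange E E' K b) = coeffMap K r a * b := by
  induction a using MonoidAlgebra.induction_linear with
  | zero => simp
  | add a a' ha ha' => simp only [map_add, add_mul, ha, ha']
  | single x c =>
    induction b using MonoidAlgebra.induction_linear with
    | zero => simp
    | add b b' hb hb' => simp only [map_add, mul_add, hb, hb']
    | single y d =>
      rw [baseChange_single, single_mul_single, coeffMap_single, coeffMap_single,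
        single_mul_single, mul_comm c, ← Algebra.smul_def, map_smul, smul_eq_mul, mul_comm d]

theorem coeffMap_baseChange_mul (r : E' →ₗ[E] E) (a : MonoidAlgebra E' K) (b : MonoidAlgebra E K) :
    coeffMap K r (baseChange E E' K b * a) = b * coeffMap K r a := by
  induction a using MonoidAlgebra.induction_linear with
  | zero => simp
  | add a a' ha ha' => simp only [map_add, mul_add, ha, ha']
  | single x c =>
    induction b using MonoidAlgebra.induction_linear with
    | zero => simp
    | add b b' hb hb' => simp only [map_add, add_mul, hb, hb']
    | single y d =>
      rw [baseChange_single, single_mul_single, coeffMap_single, coeffMap_single,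
        single_mul_single, ← Algebra.smul_def, map_smul, smul_eq_mul]

theorem coeffMap_algAut (r : E' →ₗ[E] E) (φ : MulAut K) (a : MonoidAlgebra E' K) :
    coeffMap K r (algAut E' φ a) = algAut E φ (coeffMap K r a) := by
  induction a using MonoidAlgebra.induction_linear with
  | zero => simp
  | add a b ha hb => simp only [map_add, ha, hb]
  | single x c => simp only [algAut_single, coeffMap_single]

/-- Semisimplicity descends to subfields. -/
theorem HasInvariantIdempotents.descend {Q : Subgroup (MulAut K)}
    (h : HasInvariantIdempotents (Q.map (ringAutHom E' K))) :
    HasInvariantIdempotents (Q.map (ringAutHom E K)) := by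
  rw [hasInvariantIdempotents_map_iff] at h ⊢
  intro L hL
  -- The retraction r of E' onto E carries a fixed right identity of the extended ideal to one of L.
  obtain ⟨r, hr⟩ := (Algebra.linearMap E E').exists_leftInverse_of_injective
    (LinearMap.ker_eq_bot.2 (algebraMap E E').injective)
  have hr1 : r 1 = 1 := by
    have := LinearMap.congr_fun hr 1
    simpa using this
  have hone : coeffMap K r 1 = 1 := by rw [one_def, coeffMap_single, hr1, one_def]
  let L' : Ideal (MonoidAlgebra E' K) := Ideal.span (baseChange E E' K '' L)
  have hL' : ∀ φ ∈ Q, ∀ x ∈ L', algAut E' φ x ∈ L' := by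
    intro φ hφ x hx
    induction hx using Submodule.span_induction with
    | mem x hx =>
      obtain ⟨y, hy, rfl⟩ := hx
      rw [← baseChange_algAut]
      exact Ideal.subset_span ⟨_, hL φ hφ y hy, rfl⟩
    | zero => rw [map_zero]; exact zero_mem _
    | add x y _ _ hx hy => rw [map_add]; exact add_mem hx hy
    | smul a x _ hx => rw [smul_eq_mul, map_mul]; exact L'.mul_mem_left _ hx
  have hrL : ∀ x ∈ L', coeffMap K r x ∈ L := by
    intro x hx
    obtain ⟨f, hf⟩ := (Finsupp.mem_span_image_iff_linearCombination _).1 hx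
    rw [← hf.2, Finsupp.linearCombination_apply, Finsupp.sum, map_sum]
    refine sum_mem fun y hy => ?_
    rw [smul_eq_mul, coeffMap_mul_baseChange]
    exact L.mul_mem_left _ (hf.1 hy)
  obtain ⟨e, he, hfe, hxe⟩ := h L' hL'
  refine ⟨coeffMap K r e, hrL e he, fun φ hφ => ?_, fun x hx => ?_⟩
  · rw [← coeffMap_algAut, hfe φ hφ]
  · rw [← coeffMap_baseChange_mul, hxe _ (Ideal.subset_span ⟨x, hx, rfl⟩),
      ← mul_one (baseChange E E' K x), coeffMap_baseChange_mul, hone, mul_one]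

end Descent

section FixedToIdempotents

variable (E : Type*) [Field E] [IsAlgClosed E] [Finite K] [NeZero (Nat.card K : E)]

/-- If the central characters fixed by each element `φ` of `Q` are trivial on the commutator of `K`
and `φ`, then the group algebra of `K` is semisimple over its skew group ring. -/
theorem hasInvariantIdempotents_of_fixedCentralCharactersTrivialOn (Q : Subgroup (MulAut K))
    (h : ∀ φ ∈ Q, FixedCentralCharactersTrivialOn E φ (autCommutator φ)) :
    HasInvariantIdempotents (Q.map (ringAutHom E K)) := by
  classical
  rw [hasInvariantIdempotents_map_iff]
  intro L hL
  let A := MonoidAlgebra E K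
  let X := CentralCharacter E K
  have : Fintype X := Fintype.ofFinite X
  let _ : MulAction Q X :=
    -- The inverse makes precomposition a left action.
    { smul := fun φ l => l.comp (centerMap (algAut E (φ : MulAut K)⁻¹))
      one_smul := fun l => AlgHom.ext fun z => by
        change l (centerMap (algAut E (1 : MulAut K)⁻¹) z) = l z
        rw [inv_one, centerMap_algAut_one]
      mul_smul := fun φ ψ l => AlgHom.ext fun z => by
        change l (centerMap (algAut E ((φ : MulAut K) * (ψ : MulAut K))⁻¹) z) = l (centerMap _ (centerMap _ z))
        rw [mul_inv_rev, centerMap_algAut_mul] }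
  have hsmul : ∀ (φ : Q) (l : X) z, (φ • l) z = l (centerMap (algAut E (φ : MulAut K)⁻¹) z) :=
    fun _ _ _ => rfl
  have hsmul' : ∀ (φ : Q) (l : X) z, (φ • l) (centerMap (algAut E (φ : MulAut K)) z) = l z :=
    fun φ l z => by rw [hsmul, ← centerMap_algAut_mul, inv_mul_cancel, centerMap_algAut_one]
  choose ζ hζ using fun l : X => exists_eq_eval E (Pi.single l (1 : E))
  have hζ1 : ∀ l m : X, m (ζ l) = if m = l then 1 else 0 := fun l m => by
    rw [← congrFun (hζ l) m, Pi.single_apply]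
  have hζφ : ∀ (φ : Q) (l : X), centerMap (algAut E (φ : MulAut K)) (ζ l) = ζ (φ • l) := by
    intro φ l
    refine eq_of_eval_eq E fun m => ?_
    obtain ⟨m, rfl⟩ := MulAction.surjective φ m
    rw [hsmul', hζ1, hζ1]
    simp only [smul_left_cancel_iff]
  have hsum : ∑ l : X, ζ l = 1 := eq_of_eval_eq E fun m => by
    simp [map_sum, hζ1]
  -- The hypothesis enters here: the stabilizer of l acts trivially on its block.
  have hstab : ∀ (φ : Q) (l : X), φ • l = l → ∀ a : A,
      algAut E (φ : MulAut K) ((ζ l : A) * a) = (ζ l : A) * a := by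
    intro φ l hφ a
    have h1 : l (centralIdem E (autCommutator (φ : MulAut K))) = 1 := h φ φ.2 l fun z => by
      conv_lhs => rw [← hφ, hsmul']
    have h2 : centralIdem E (autCommutator (φ : MulAut K)) * ζ l = ζ l :=
      eq_of_eval_eq E fun m => by
        rw [map_mul, hζ1]
        split_ifs with hm
        · rw [hm, h1, one_mul]
        · rw [mul_zero]
    have h3 : averageIdem E (autCommutator (φ : MulAut K)) * (ζ l : A) = ζ l :=
      congrArg Subtype.val h2
    have h4 := averageIdem_mul_algAut E _ (mul_inv_mem_autCommutator (φ : MulAut K))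
      ((ζ l : A) * a)
    have h5 : algAut E (φ : MulAut K) (ζ l : A) = ζ l := by
      rw [← coe_centerMap, hζφ, hφ]
    rw [map_mul, h5, ← mul_assoc, ← mul_assoc, h3] at h4
    rw [map_mul, h5, h4]
  have hc : ∀ (l : X) (a : A), a * (ζ l : A) = (ζ l : A) * a := fun l a =>
    Subalgebra.mem_center_iff.1 (ζ l).2 a
  obtain ⟨ε, hεL, hε⟩ := exists_mul_eq_self_of_isCompl (exists_isCompl L).choose_spec
  let rep : X → X := fun l => (Quotient.mk (MulAction.orbitRel Q X) l).out
  have hrep : ∀ l, ∃ g : Q, g • rep l = l := fun l =>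
    Setoid.symm' _ (Quotient.mk_out (s := MulAction.orbitRel Q X) l)
  have hrepφ : ∀ (φ : Q) l, rep (φ • l) = rep l := fun φ l => by
    have : (Quotient.mk (MulAction.orbitRel Q X) (φ • l)) = Quotient.mk _ l :=
      Quotient.sound ⟨φ, rfl⟩
    simp only [rep, this]
  choose g hg using hrep
  -- The right identity ε is used only in one block per orbit and carried to the others; by `hstab`
  -- the result does not depend on the transporting element.
  let c : X → A := fun l => algAut E (g l : MulAut K) ((ζ (rep l) : A) * ε)
  have hcφ : ∀ (φ : Q) l, algAut E (φ : MulAut K) (c l) = c (φ • l) := by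
    intro φ l
    have hst : ((g (φ • l))⁻¹ * φ * g l) • rep l = rep l := by
      rw [mul_smul, mul_smul, hg, inv_smul_eq_iff, ← hrepφ φ l, hg]
    have h1 := hstab _ _ hst ε
    have h2 := congrArg (algAut E (g (φ • l) : MulAut K)) h1
    simp only [c]
    rw [hrepφ, ← h2, ← algAut_mul, ← algAut_mul, ← Subgroup.coe_mul, ← Subgroup.coe_mul,
      ← mul_assoc, ← mul_assoc, mul_inv_cancel, one_mul]
  have hcL : ∀ l, c l ∈ L := fun l => hL _ (g l).2 _ (L.mul_mem_left _ hεL)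
  have hxc : ∀ l, ∀ x ∈ L, x * c l = (ζ l : A) * x := by
    intro l x hx
    obtain ⟨y, rfl⟩ := (algAut E (g l : MulAut K)).surjective x
    have hy : y ∈ L := by
      have := hL _ (inv_mem (g l).2) _ hx
      rwa [← algAut_mul, inv_mul_cancel, algAut, map_one, AlgEquiv.one_apply] at this
    have h1 : (ζ l : A) = algAut E (g l : MulAut K) (ζ (rep l) : A) := by
      rw [← coe_centerMap, hζφ, hg]
    rw [h1, ← map_mul, ← map_mul, ← mul_assoc, hc, mul_assoc, hε y hy]
  refine ⟨∑ l, c l, sum_mem fun l _ => hcL l, fun φ hφ => ?_, fun x hx => ?_⟩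
  · rw [map_sum]
    exact Fintype.sum_equiv (MulAction.toPerm (⟨φ, hφ⟩ : Q)) _ _ fun l => hcφ ⟨φ, hφ⟩ l
  · rw [Finset.mul_sum, Finset.sum_congr rfl fun l _ => hxc l x hx, ← Finset.sum_mul]
    have := congrArg Subtype.val hsum
    rw [AddSubmonoidClass.coe_finsetSum] at this
    rw [this]
    exact one_mul x

end FixedToIdempotents

end GroupAlgebra

/-! ### An automorphism of p-power order on a matrix block. -/

/-- Since n^(j+1) = n^(j+1) e = e n^(j+1) = y n^(j+2), vanishing of a power forces vanishing of the
previous one. -/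
theorem eq_zero_of_mul_idempotent {B : Type*} [Ring B] {n e y : B} {k : ℕ} (hn : n ^ k = 0)
    (he : e = y * n) (hne : n * e = n) (hc : Commute n e) : n = 0 := by
  have step : ∀ j : ℕ, n ^ (j + 1 + 1) = 0 → n ^ (j + 1) = 0 := by
    intro j hj
    calc n ^ (j + 1) = n ^ (j + 1) * e := by rw [pow_succ, mul_assoc, hne]
      _ = y * n ^ (j + 1 + 1) := by
        rw [(hc.pow_left (j + 1)).eq, he, mul_assoc, ← pow_succ']
      _ = 0 := by rw [hj, mul_zero]
  have key : ∀ j : ℕ, n ^ (j + 1) = 0 → n = 0 := by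
    intro j
    induction j with
    | zero => intro h; simpa using h
    | succ j ih => exact fun h => ih (step j h)
  exact key k (by rw [pow_succ, hn, zero_mul])

/-- If `A` is semisimple over its skew group ring with respect to an automorphism `s` of `p`-power
order, and `s` induces an inner automorphism on a quotient matrix algebra of `A` over a finite
field of characteristic `p`, then this inner automorphism is trivial. -/
theorem HasInvariantIdempotents.eq_of_inner {A D V : Type*} [Ring A] [Field D] [Finite D]
    [AddCommGroup V] [Module D V] [Module.Finite D V] {p a : ℕ} [Fact p.Prime] [CharP D p]
    {s : RingAut A} (hs : s ^ p ^ a = 1) (h : HasInvariantIdempotents (Subgroup.zpowers s))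
    (π : A →+* Module.End D V) (hπ : Function.Surjective π) (T : (Module.End D V)ˣ)
    (hT : ∀ x, π (s x) = T * π x * (T⁻¹ : (Module.End D V)ˣ)) (x : A) : π (s x) = π x := by
  rcases subsingleton_or_nontrivial V with hV | hV
  · exact Subsingleton.elim _ _
  let B := Module.End D V
  have hTpow : ∀ (k : ℕ) x, π ((s ^ k) x) = (T ^ k : Bˣ) * π x * ((T ^ k)⁻¹ : Bˣ) := by
    intro k
    induction k with
    | zero => intro x; simp
    | succ k ih =>
      intro x
      rw [pow_succ, RingAut.mul_apply, ih, hT, pow_succ, mul_inv_rev]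
      simp only [Units.val_mul, mul_assoc]
  have hcomm : ∀ b : B, Commute ((T ^ p ^ a : Bˣ) : B) b := by
    intro b
    obtain ⟨x, rfl⟩ := hπ b
    have := hTpow (p ^ a) x
    rw [hs, RingAut.one_apply] at this
    rw [Commute, SemiconjBy]
    conv_rhs => rw [this]
    rw [mul_assoc, mul_assoc, Units.inv_mul, mul_one]
  obtain ⟨c, hc⟩ : ∃ c : D, algebraMap D B c = ((T ^ p ^ a : Bˣ) : B) := by
    have : ((T ^ p ^ a : Bˣ) : B) ∈ Subalgebra.center D B :=
      Subalgebra.mem_center_iff.2 fun b => (hcomm b).symm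
    rw [Algebra.IsCentral.center_eq_bot, Algebra.mem_bot] at this
    exact this
  have hp := Fact.out (p := p.Prime)
  -- The finite field D is perfect, so the scalar T^(p^a) has a p^a-th root, and dividing T by it
  -- gives u with u^(p^a) = 1.
  obtain ⟨d, hd⟩ : ∃ d : D, d ^ p ^ a = c := by
    obtain ⟨d, hd⟩ := (iterateFrobeniusEquiv D p a).surjective c
    exact ⟨d, by rw [← hd, iterateFrobeniusEquiv_def]⟩
  have hc0 : c ≠ 0 := by
    rintro rfl
    rw [map_zero] at hc
    exact (T ^ p ^ a).ne_zero hc.symm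
  have hd0 : d ≠ 0 := by
    rintro rfl
    exact hc0 (by rw [← hd, zero_pow (pow_pos hp.pos a).ne'])
  let u : B := algebraMap D B d⁻¹ * T
  have hcd : ∀ b : B, Commute (algebraMap D B d⁻¹) b := fun b => Algebra.commutes _ _
  have hu : u ^ p ^ a = 1 := by
    rw [(hcd _).mul_pow, ← Units.val_pow_eq_pow_val, ← hc, ← map_pow, ← map_mul, inv_pow, hd,
      inv_mul_cancel₀ hc0, map_one]
  have hus : ∀ x, π (s x) * u = u * π x := by
    intro x
    simp only [u]
    rw [← mul_assoc, ← (hcd _).eq, mul_assoc, mul_assoc, hT, mul_assoc, Units.inv_mul, mul_one]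
  have hchar : CharP B p := charP_of_injective_algebraMap (algebraMap D B).injective p
  let n : B := u - 1
  have hn : n ^ p ^ a = 0 := by
    have : ExpChar B p := ExpChar.prime hp
    simp only [n]
    rw [sub_pow_expChar_pow_of_commute p _ (Commute.one_right u), hu, one_pow, sub_self]
  -- This left ideal is stable under s because s acts on the block as conjugation by u, which
  -- commutes with n = u - 1.
  let L : Ideal A := Ideal.comap π (Ideal.span {n})
  have hmem : ∀ x, x ∈ L ↔ ∃ y, y * n = π x := fun x => by
    rw [Ideal.mem_comap, Ideal.mem_span_singleton']
  have hLs : ∀ x ∈ L, s x ∈ L := by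
    intro x hx
    rw [hmem] at hx ⊢
    obtain ⟨y, hy⟩ := hx
    obtain ⟨y, rfl⟩ := hπ y
    refine ⟨π (s y), ?_⟩
    have h1 : π (s y) * n * u = π (s x) * u := by
      have hnu : n * u = u * n := by simp only [n, sub_mul, mul_sub, one_mul, mul_one]
      rw [mul_assoc, hnu, ← mul_assoc, hus, mul_assoc, hy, hus]
    have hunit : IsUnit u := (isUnit_pow_iff (pow_pos hp.pos a).ne').1 (hu ▸ isUnit_one)
    exact hunit.mul_right_cancel h1
  have hLs' : ∀ f ∈ Subgroup.zpowers s, ∀ x ∈ L, f x ∈ L := by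
    intro f hf
    have hfin : IsOfFinOrder s := isOfFinOrder_iff_pow_eq_one.2 ⟨_, pow_pos hp.pos a, hs⟩
    obtain ⟨k, rfl⟩ := hfin.mem_powers_iff_mem_zpowers.2 hf
    clear hf
    change ∀ x ∈ L, (s ^ k) x ∈ L
    induction k with
    | zero => exact fun x hx => hx
    | succ k ih =>
      intro x hx
      rw [pow_succ, RingAut.mul_apply]
      exact ih _ (hLs x hx)
  obtain ⟨e, he, hse, hxe⟩ := h L hLs'
  obtain ⟨y, hy⟩ := (hmem e).1 he
  have hsu : u * π e = π e * u := by
    rw [← hus, hse s (Subgroup.mem_zpowers s)]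
  have hne : n * π e = n := by
    obtain ⟨x, hx⟩ := hπ n
    have hxL : x ∈ L := (hmem x).2 ⟨1, by rw [one_mul, hx]⟩
    rw [← hx, ← map_mul, hxe x hxL]
  have hn0 : n = 0 := eq_zero_of_mul_idempotent hn hy.symm hne (by
    rw [Commute, SemiconjBy]
    simp only [n, sub_mul, mul_sub, one_mul, mul_one, hsu])
  have hu1 : u = 1 := sub_eq_zero.1 hn0
  have := hus x
  rwa [hu1, mul_one, one_mul] at this

universe u

section Block

variable {F A E : Type*} [Field F] [Ring A] [Algebra F A] [Field E]

/-- If an automorphism of an algebra fixes a point of the centre, it induces an inner automorphism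
of the corresponding matrix block. -/
theorem exists_inner_of_fixed_point {D V : Type*} [Field D] [AddCommGroup V] [Module D V]
    [Module.Finite D V] (l : Subalgebra.center F A →+* E) (s : A ≃ₐ[F] A)
    (hl : ∀ z, l (centerMap s z) = l z) (π : A →+* Module.End D V) (hπ : Function.Surjective π)
    (ζ : Subalgebra.center F A) (hζ : ∀ x : A, π x = 0 ↔ ζ * x = 0) (hζζ : ζ * ζ = ζ)
    (hlζ : l ζ = 1) :
    (∀ z : Subalgebra.center F A, π z = 0 → l z = 0) ∧
      ∃ T : (Module.End D V)ˣ, ∀ x, π (s x) = T * π x * (T⁻¹ : (Module.End D V)ˣ) := by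
  have hcen : ∀ z : Subalgebra.center F A, ∀ x : A, x * z = z * x := fun z =>
    Subalgebra.mem_center_iff.1 z.2
  have hπζ : π ζ = 1 := by
    have : π (1 - (ζ : A)) = 0 := by
      rw [hζ, mul_sub, mul_one]
      exact sub_eq_zero.2 (congrArg Subtype.val hζζ).symm
    rw [map_sub, map_one] at this
    exact (sub_eq_zero.1 this).symm
  have hscalar : ∀ z : Subalgebra.center F A, ∃ c : D, π z = algebraMap D _ c := by
    intro z
    have : π z ∈ Subalgebra.center D (Module.End D V) :=
      Subalgebra.mem_center_iff.2 fun b => by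
        obtain ⟨x, rfl⟩ := hπ b
        rw [← map_mul, ← map_mul, hcen]
    rw [Algebra.IsCentral.center_eq_bot, Algebra.mem_bot] at this
    exact this.imp fun _ h => h.symm
  have hlift : ∀ c : D, ∃ z : Subalgebra.center F A, π z = algebraMap D _ c := by
    intro c
    obtain ⟨x, hx⟩ := hπ (algebraMap D _ c)
    refine ⟨⟨ζ * x, Subalgebra.mem_center_iff.2 fun y => ?_⟩, by
      change π (ζ * x) = _
      rw [map_mul, hπζ, one_mul, hx]⟩
    have h1 : (ζ : A) * (y * x - x * y) = 0 := by
      rw [← hζ, map_sub, map_mul, map_mul, hx, Algebra.commutes, sub_self]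
    rw [mul_sub, sub_eq_zero] at h1
    rw [← mul_assoc, hcen, mul_assoc, h1, mul_assoc]
  have hker : ∀ z : Subalgebra.center F A, π z = 0 → l z = 0 := by
    intro z hz
    have : ζ * z = 0 := Subtype.ext ((hζ z).1 hz)
    rw [← one_mul (l z), ← hlζ, ← map_mul, this, map_zero]
  -- The centre of A maps onto the scalars of the block, a field, so l and π have the same kernel on
  -- it. An automorphism fixing l is therefore trivial on the scalars.
  have hker' : ∀ z : Subalgebra.center F A, l z = 0 → π z = 0 := by
    intro z hz
    by_contra hne
    obtain ⟨c, hc⟩ := hscalar z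
    have hc0 : c ≠ 0 := by
      rintro rfl
      exact hne (by rw [hc, map_zero])
    obtain ⟨w, hw⟩ := hlift c⁻¹
    have h1 := hker (z * w - 1) (by
      change π ((z : A) * w - 1) = 0
      rw [map_sub, map_mul, hc, hw, ← map_mul, mul_inv_cancel₀ hc0, map_one, map_one, sub_self])
    rw [map_sub, map_mul, hz, zero_mul, map_one, zero_sub, neg_eq_zero] at h1
    exact one_ne_zero h1
  have hfix : ∀ t : A ≃ₐ[F] A, (∀ z, l (centerMap t z) = l z) →
      ∀ z : Subalgebra.center F A, π (t z) = π z := by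
    intro t ht z
    have h1 := hker' (centerMap t z - z) (by rw [map_sub, ht, sub_self])
    have h2 : π (t z - z) = 0 := h1
    rw [map_sub] at h2
    exact sub_eq_zero.1 h2
  have hstab : ∀ t : A ≃ₐ[F] A, (∀ z, l (centerMap t z) = l z) → ∀ x, π x = 0 → π (t x) = 0 := by
    intro t ht x hx
    have h1 := congrArg (fun y => π (t y)) ((hζ x).1 hx)
    simp only [map_mul, map_zero, hfix t ht, hπζ, one_mul] at h1
    exact h1
  have hl' : ∀ z, l (centerMap s.symm z) = l z := fun z => by
    rw [← hl]
    congr 1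
    exact Subtype.ext (s.apply_symm_apply z)
  have hinv := Function.rightInverse_surjInv hπ
  let σ : Module.End D V →+* Module.End D V := π.liftOfRightInverse _ hinv
    ⟨π.comp (s : A →+* A), fun x hx => hstab s hl x hx⟩
  let τ : Module.End D V →+* Module.End D V := π.liftOfRightInverse _ hinv
    ⟨π.comp (s.symm : A →+* A), fun x hx => hstab s.symm hl' x hx⟩
  have hσ : ∀ x, σ (π x) = π (s x) := fun x => π.liftOfRightInverse_comp_apply _ hinv _ x
  have hτ : ∀ x, τ (π x) = π (s.symm x) := fun x => π.liftOfRightInverse_comp_apply _ hinv _ x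
  let σe : Module.End D V ≃ₐ[D] Module.End D V :=
    AlgEquiv.ofRingEquiv (f := RingEquiv.ofRingHom σ τ
      (RingHom.ext fun b => by
        obtain ⟨x, rfl⟩ := hπ b
        simp [hσ, hτ])
      (RingHom.ext fun b => by
        obtain ⟨x, rfl⟩ := hπ b
        simp [hσ, hτ])) fun c => by
        obtain ⟨z, hz⟩ := hlift c
        rw [← hz]
        exact (hσ z).trans (hfix s hl z)
  refine ⟨hker, ?_⟩
  -- Skolem–Noether: a D-linear automorphism of a matrix algebra is inner.
  obtain ⟨T, hT⟩ := σe.eq_linearEquivConjAlgEquiv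
  refine ⟨⟨T, T.symm, by ext; simp, by ext; simp⟩, fun x => ?_⟩
  rw [← hσ]
  exact congrArg (fun f : Module.End D V ≃ₐ[D] Module.End D V => f (π x)) hT

/-- The Wedderburn block of a finite semisimple algebra belonging to a point of the centre. -/
theorem exists_block {F : Type*} {A : Type u} {E : Type*} [Field F] [Ring A] [Algebra F A]
    [Field E] [Finite F] [Module.Finite F A] [IsSemisimpleRing A]
    (l : Subalgebra.center F A →+* E) :
    ∃ (D : Type u) (_ : Field D) (_ : Algebra F D) (_ : Finite D) (d : ℕ)
      (π : A →ₐ[F] Module.End D (Fin d → D)) (ζ : Subalgebra.center F A),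
      Function.Surjective π ∧ (∀ x : A, π x = 0 ↔ ζ * x = 0) ∧ ζ * ζ = ζ ∧ l ζ = 1 := by
  classical
  -- Wedderburn–Artin; the division rings are finite, hence fields.
  obtain ⟨n, D, d, _, _, _, _, ⟨e⟩⟩ :=
    IsSemisimpleRing.exists_algEquiv_pi_matrix_divisionRing_finite F A
  have hfin : ∀ i, Finite (D i) := fun i => Module.finite_of_finite F
  let ζ : Fin n → Subalgebra.center F A := fun i => ⟨e.symm (Pi.single i 1), by
    rw [Subalgebra.mem_center_iff]
    intro b
    refine e.injective ?_
    rw [map_mul, map_mul, e.apply_symm_apply]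
    ext j : 1
    by_cases h : j = i
    · subst h; simp
    · simp [Pi.single_eq_of_ne h]⟩
  have hζζ : ∀ i, ζ i * ζ i = ζ i := fun i => by
    refine Subtype.ext ?_
    change e.symm _ * e.symm _ = e.symm _
    rw [← map_mul, ← Pi.single_mul, one_mul]
  have hsum : ∑ i, ζ i = 1 := by
    refine Subtype.ext ?_
    rw [AddSubmonoidClass.coe_finsetSum]
    change ∑ i, e.symm (Pi.single i 1) = 1
    rw [← map_sum, Finset.univ_sum_single, ← Pi.one_def, map_one]
  obtain ⟨i, hi⟩ : ∃ i, l (ζ i) ≠ 0 := by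
    by_contra! h
    have := congrArg l hsum
    rw [map_sum, Finset.sum_eq_zero fun i _ => h i, map_one] at this
    exact zero_ne_one this
  have hi1 : l (ζ i) = 1 := by
    have := congrArg l (hζζ i)
    rw [map_mul] at this
    exact mul_right_cancel₀ hi (this.trans (one_mul _).symm)
  let m : Matrix (Fin (d i)) (Fin (d i)) (D i) ≃ₐ[F] Module.End (D i) (Fin (d i) → D i) :=
    (Matrix.toLinAlgEquiv' (R := D i) (n := Fin (d i))).restrictScalars F
  let π : A →ₐ[F] Module.End (D i) (Fin (d i) → D i) :=
    (m : _ →ₐ[F] _).comp ((Pi.evalAlgHom F (fun i => Matrix (Fin (d i)) (Fin (d i)) (D i)) i).comp (e : A →ₐ[F] _))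
  have hπ : ∀ x, π x = m (e x i) := fun x => rfl
  refine ⟨D i, inferInstance, inferInstance, hfin i, d i, π, ζ i, ?_, ?_, hζζ i, hi1⟩
  · intro b
    refine ⟨e.symm (Pi.single i (m.symm b)), ?_⟩
    rw [hπ, e.apply_symm_apply, Pi.single_eq_same, m.apply_symm_apply]
  · intro x
    rw [hπ, map_eq_zero_iff m m.injective, ← map_eq_zero_iff e e.injective]
    change _ ↔ e (e.symm (Pi.single i 1) * x) = 0
    rw [map_mul, e.apply_symm_apply]
    constructor
    · intro h
      ext j : 1
      by_cases hj : j = i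
      · subst hj; simp [h]
      · simp [Pi.single_eq_of_ne hj]
    · intro h
      have := congrFun h i
      simpa using this

end Block

section GroupAlgebra

open MonoidAlgebra

variable {K : Type*} [Group K]

theorem baseChange_mem_center {E E' : Type*} [Field E] [Field E'] [Algebra E E']
    {a : MonoidAlgebra E K} (ha : a ∈ Subalgebra.center E (MonoidAlgebra E K)) :
    baseChange E E' K a ∈ Subalgebra.center E' (MonoidAlgebra E' K) := by
  rw [mem_center_iff_coeff] at ha ⊢
  intro x y h
  simp [ha x y h]

variable [Finite K]

theorem baseChange_averageIdem (E E' : Type*) [Field E] [Field E'] [Algebra E E']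
    (N : Subgroup K) : baseChange E E' K (averageIdem E N) = averageIdem E' N := by
  have : Fintype N := Fintype.ofFinite N
  have hsmul : ∀ (c : E) (a : MonoidAlgebra E K),
      baseChange E E' K (c • a) = algebraMap E E' c • baseChange E E' K a := by
    intro c a
    ext x
    simp [Algebra.smul_def]
  rw [averageIdem, averageIdem, hsmul, finsum_eq_sum_of_fintype, finsum_eq_sum_of_fintype, map_sum,
    map_inv₀, map_natCast]
  simp only [baseChange_single, map_one]

/-- The central characters fixed by an automorphism `φ` of `p`-power order are trivial on the
commutator of `K` and `φ` if the group algebra over a finite field is semisimple over its skew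
group ring with respect to `φ`. -/
theorem fixedCentralCharactersTrivialOn_of_hasInvariantIdempotents {F E : Type*} [Field F]
    [Finite F] [Field E] [Algebra F E] [NeZero (Nat.card K : F)] {p a : ℕ} [Fact p.Prime]
    [CharP F p] {φ : MulAut K} (hφ : φ ^ p ^ a = 1)
    (h : HasInvariantIdempotents (Subgroup.zpowers (ringAutHom F K φ))) :
    FixedCentralCharactersTrivialOn E φ (autCommutator φ) := by
  intro l hl
  -- The restriction of l to the centre over F takes values in the larger field E, but still singles
  -- out one Wedderburn block over F.
  let l₀ : Subalgebra.center F (MonoidAlgebra F K) →+* E :=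
    (l : _ →+* E).comp (((baseChange F E K).comp
      (Subalgebra.center F (MonoidAlgebra F K)).val.toRingHom).codRestrict
        (Subalgebra.center E (MonoidAlgebra E K)) fun z => baseChange_mem_center z.2)
  have hl₀ : ∀ z, l₀ z = l ⟨baseChange F E K z, baseChange_mem_center z.2⟩ := fun z => rfl
  have hl₀φ : ∀ z, l₀ (centerMap (algAut F φ) z) = l₀ z := by
    intro z
    rw [hl₀, hl₀, ← hl ⟨baseChange F E K z, _⟩]
    congr 1
    exact Subtype.ext (baseChange_algAut φ _)
  obtain ⟨D, _, _, _, d, π, ζ, hπ, hζ, hζζ, hlζ⟩ := exists_block l₀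
  have : CharP D p := charP_of_injective_algebraMap (algebraMap F D).injective p
  obtain ⟨hker, T, hT⟩ :=
    exists_inner_of_fixed_point l₀ (algAut F φ) hl₀φ π.toRingHom hπ ζ hζ hζζ hlζ
  have hs : ringAutHom F K φ ^ p ^ a = 1 := by rw [← map_pow, hφ, map_one]
  have key : ∀ x, π (algAut F φ x) = π x := h.eq_of_inner hs π.toRingHom hπ T hT
  have hle : autCommutator φ ≤ (π.toRingHom.toMonoidHom.comp (of F K)).ker := by
    rw [autCommutator_le_iff]
    intro x
    rw [MonoidHom.mem_ker]
    change π (single (φ x * x⁻¹) 1) = 1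
    have h1 : (single (φ x * x⁻¹) 1 : MonoidAlgebra F K) =
        algAut F φ (single x 1) * single x⁻¹ 1 := by
      rw [algAut_single, single_mul_single, mul_one]
    rw [h1, map_mul, key, ← map_mul, single_mul_single, mul_inv_cancel, mul_one, ← one_def, map_one]
  have hav : π (averageIdem F (autCommutator φ)) = 1 :=
    map_averageIdem_eq F (autCommutator φ) π.toLinearMap 1 fun n hn => hle hn
  have h0 := hker (centralIdem F (autCommutator φ) - 1) (by
    change π (averageIdem F (autCommutator φ) - 1) = 0
    rw [map_sub, hav, map_one, sub_self])
  rw [map_sub, map_one, sub_eq_zero, hl₀] at h0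
  rw [← h0]
  congr 1
  exact Subtype.ext (baseChange_averageIdem F E _).symm

end GroupAlgebra

/-! ### The induced module as a group algebra. -/

section Induced

open MonoidAlgebra Representation

variable (F : Type*) [Field F] {G : Type*} [Group G] (P K : Subgroup G)

/-- The generators of the induced module `1_P^G`. -/
noncomputable def inducedGen (g : G) : IndV P.subtype (Representation.trivial F P F) :=
  IndV.mk P.subtype (Representation.trivial F P F) g 1

theorem inducedTrivial_gen (g h : G) :
    inducedTrivial F P g (inducedGen F P h) = inducedGen F P (h * g⁻¹) :=
  ind_mk _ _ _ _ _

theorem inducedGen_mul {h : G} (hh : h ∈ P) (g : G) :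
    inducedGen F P (h * g) = inducedGen F P g := by
  have := Coinvariants.mk_self_apply (Representation.tprod ((leftRegular F G).comp P.subtype)
    (Representation.trivial F P F)) ⟨h, hh⟩ (single g 1 ⊗ₜ 1)
  simpa [inducedGen] using this

/-- The map from the group algebra of `K` to `1_P^G` given by the action on the generator. -/
noncomputable def toInduced :
    MonoidAlgebra F K →ₗ[F] IndV P.subtype (Representation.trivial F P F) :=
  -- Generators depend only on the coset Pg, and G acts by right multiplication with the inverse;
  -- hence the inverse of x.
  (Finsupp.linearCombination F fun x : K => inducedGen F P (x : G)⁻¹) ∘ₗ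
    (coeffLinearEquiv F).toLinearMap

theorem toInduced_single (x : K) (c : F) :
    toInduced F P K (single x c) = c • inducedGen F P (x : G)⁻¹ := by
  simp [toInduced]

theorem inducedTrivial_toInduced_of_mem_left (k : K) (a : MonoidAlgebra F K) :
    inducedTrivial F P k (toInduced F P K a) = toInduced F P K (single k 1 * a) := by
  induction a using MonoidAlgebra.induction_linear with
  | zero => simp
  | add a b ha hb => simp only [map_add, mul_add, ha, hb]
  | single x c =>
    rw [single_mul_single, toInduced_single, toInduced_single, map_smul, inducedTrivial_gen,
      one_mul]
    simp

/-- Every coset Pg contains the inverse of exactly one element of K, the K-component of g⁻¹; sending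
the generator of g to it inverts the map. -/
theorem toInduced_bijective {P K : Subgroup G} (hC : Subgroup.IsComplement' K P) :
    Function.Bijective (toInduced F P K) := by
  let r : G → K := fun g => (hC.equiv g⁻¹).1
  have hr : ∀ h ∈ P, ∀ g, r (h * g) = r g := by
    intro h hh g
    simp only [r]
    rw [mul_inv_rev, hC.equiv_mul_right_of_mem (inv_mem hh)]
  have hrK : ∀ x : K, r (x : G)⁻¹ = x := by
    intro x
    simp only [r]
    rw [inv_inv, hC.equiv_fst_eq_self_of_mem_of_one_mem P.one_mem x.2]
    rfl
  have hr' : ∀ g, ∃ h ∈ P, g = h * (r g : G)⁻¹ := by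
    intro g
    refine ⟨((hC.equiv g⁻¹).2 : G)⁻¹, inv_mem (hC.equiv g⁻¹).2.2, ?_⟩
    rw [← mul_inv_rev, hC.equiv_fst_mul_equiv_snd, inv_inv]
  let f : IndV P.subtype (Representation.trivial F P F) →ₗ[F] MonoidAlgebra F K :=
    Coinvariants.lift _ (mapDomainLinearMap F F r ∘ₗ (TensorProduct.rid F _).toLinearMap) fun h => by
      ext g
      simp [hr h h.2]
  have hf : ∀ g, f (inducedGen F P g) = single (r g) 1 := fun g => by
    simp [f, inducedGen]
  constructor
  · have hleft : f ∘ₗ toInduced F P K = LinearMap.id := by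
      refine MonoidAlgebra.lhom_ext' fun x => LinearMap.ext_ring ?_
      change f (toInduced F P K (single x 1)) = single x 1
      rw [toInduced_single, one_smul, hf, hrK]
    exact Function.LeftInverse.injective (g := f) (LinearMap.congr_fun hleft)
  · have hright : toInduced F P K ∘ₗ f = LinearMap.id := by
      refine IndV.hom_ext _ _ fun g => LinearMap.ext_ring ?_
      change toInduced F P K (f (inducedGen F P g)) = inducedGen F P g
      rw [hf, toInduced_single, one_smul]
      obtain ⟨h, hh, hg⟩ := hr' g
      conv_rhs => rw [hg, inducedGen_mul F P hh]
    exact Function.RightInverse.surjective (g := f) (LinearMap.congr_fun hright)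

variable [K.Normal]

/-- The coset P x⁻¹h⁻¹ equals P h x⁻¹h⁻¹, which belongs to h x h⁻¹. -/
theorem inducedTrivial_toInduced_of_mem_right {h : G} (hh : h ∈ P) (a : MonoidAlgebra F K) :
    inducedTrivial F P h (toInduced F P K a) =
      toInduced F P K (algAut F (MulAut.conjNormal h) a) := by
  induction a using MonoidAlgebra.induction_linear with
  | zero => simp
  | add a b ha hb => simp only [map_add, ha, hb]
  | single x c =>
    rw [algAut_single, toInduced_single, toInduced_single, map_smul, inducedTrivial_gen,
      MulAut.conjNormal_apply, mul_inv_rev, mul_inv_rev, inv_inv, inducedGen_mul F P hh]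

variable {P K}

/-- Subrepresentations of `1_P^G` correspond to the left ideals of the group algebra of a normal
complement `K` of `P` that are stable under `P`. -/
noncomputable def subrepresentationOrderIso (hC : Subgroup.IsComplement' K P) :
    Subrepresentation (inducedTrivial F P) ≃o
      Submodule (skewRing ((P.map (MulAut.conjNormal : G →* MulAut K)).map (ringAutHom F K)))
        (MonoidAlgebra F K) where
  toFun W := Ideal.toSkewSubmodule
    { carrier := {a | toInduced F P K a ∈ W.toSubmodule}
      add_mem' := fun ha hb => by
        simp only [Set.mem_ofPred_eq, map_add] at *
        exact add_mem ha hb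
      zero_mem' := by simp
      smul_mem' := fun b a ha => by
        simp only [Set.mem_ofPred_eq, smul_eq_mul] at *
        induction b using MonoidAlgebra.induction_linear with
        | zero => simp
        | add b c hb hc => rw [add_mul, map_add]; exact add_mem hb hc
        | single k c =>
          have h1 : (single k c : MonoidAlgebra F K) = c • single k 1 := by simp
          rw [h1, smul_mul_assoc, map_smul, ← inducedTrivial_toInduced_of_mem_left]
          exact W.toSubmodule.smul_mem c (W.apply_mem_toSubmodule _ ha) } (by
      rintro _ ⟨_, ⟨h, hh, rfl⟩, rfl⟩ a ha
      change toInduced F P K (algAut F (MulAut.conjNormal h) a) ∈ W.toSubmodule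
      rw [← inducedTrivial_toInduced_of_mem_right F P K hh]
      exact W.apply_mem_toSubmodule h ha)
  invFun L :=
    { toSubmodule := (L.toStableIdeal.restrictScalars F).map (toInduced F P K)
      apply_mem_toSubmodule := by
        rintro g _ ⟨a, ha, rfl⟩
        obtain ⟨⟨k, h⟩, rfl⟩ := hC.2 g
        refine ⟨single k 1 * algAut F (MulAut.conjNormal (h : G)) a, ?_, ?_⟩
        · exact L.toStableIdeal.mul_mem_left _
            (L.apply_mem_toStableIdeal (f := ringAutHom F K (MulAut.conjNormal (h : G)))
              ⟨_, ⟨h, h.2, rfl⟩, rfl⟩ ha)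
        · rw [← inducedTrivial_toInduced_of_mem_left,
            ← inducedTrivial_toInduced_of_mem_right F P K h.2, ← Module.End.mul_apply, ← map_mul] }
  left_inv W := by
    refine Subrepresentation.toSubmodule_injective (Submodule.ext fun v => ?_)
    constructor
    · rintro ⟨a, ha, rfl⟩
      exact ha
    · intro hv
      obtain ⟨a, rfl⟩ := (toInduced_bijective F hC).2 v
      exact ⟨a, hv, rfl⟩
  right_inv L := by
    ext a
    constructor
    · rintro ⟨b, hb, hab⟩
      rw [← (toInduced_bijective F hC).1 hab]
      exact hb
    · intro ha
      exact ⟨a, ha, rfl⟩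
  map_rel_iff' {W W'} := by
    constructor
    · intro h v hv
      obtain ⟨a, rfl⟩ := (toInduced_bijective F hC).2 v
      exact h (show a ∈ _ from hv)
    · intro h a ha
      exact h ha

theorem isSemisimpleRepresentation_inducedTrivial_iff (hC : Subgroup.IsComplement' K P) :
    (inducedTrivial F P).IsSemisimpleRepresentation ↔ HasInvariantIdempotents
      ((P.map (MulAut.conjNormal : G →* MulAut K)).map (ringAutHom F K)) := by
  rw [hasInvariantIdempotents_iff]
  exact (subrepresentationOrderIso F hC).complementedLattice_iff

end Induced

/-! ### Assembling the equivalence. -/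

/-- For a `p`-group `Q` of automorphisms of a `p'`-group `K`, semisimplicity of the group algebra in
characteristic `p` over its skew group ring, in terms of complex central characters. -/
theorem hasInvariantIdempotents_iff_fixedCentralCharactersTrivialOn {K : Type*} [Group K]
    [Finite K] {p : ℕ} [Fact p.Prime] (hK : ¬ p ∣ Nat.card K) (F : Type*) [Field F] [CharP F p]
    {Q : Subgroup (MulAut K)} (hQ : IsPGroup p Q) :
    HasInvariantIdempotents (Q.map (ringAutHom F K)) ↔
      ∀ φ ∈ Q, FixedCentralCharactersTrivialOn ℂ φ (autCommutator φ) := by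
  let E := AlgebraicClosure F
  have : CharP E p := charP_of_injective_algebraMap (algebraMap F E).injective p
  have : NeZero (Nat.card K : E) := ⟨fun h => hK ((CharP.cast_eq_zero_iff E p _).1 h)⟩
  have : NeZero (Nat.card K : ZMod p) :=
    ⟨fun h => hK ((CharP.cast_eq_zero_iff (ZMod p) p _).1 h)⟩
  have : NeZero (Nat.card K : ℂ) := ⟨Nat.cast_ne_zero.2 Nat.card_pos.ne'⟩
  have hpow : ∀ φ ∈ Q, ∃ a : ℕ, φ ^ p ^ a = 1 := fun φ hφ =>
    (hQ ⟨φ, hφ⟩).imp fun a ha => congrArg Subtype.val ha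
  have hcongr : ∀ φ ∈ Q, (FixedCentralCharactersTrivialOn ℂ φ (autCommutator φ) ↔
      FixedCentralCharactersTrivialOn E φ (autCommutator φ)) := fun φ hφ => by
    obtain ⟨a, ha⟩ := hpow φ hφ
    exact fixedCentralCharactersTrivialOn_congr ℂ E ha (mul_inv_mem_autCommutator φ)
  constructor
  · intro h φ hφ
    rw [hcongr φ hφ]
    let _ : Algebra (ZMod p) F := ZMod.algebra F p
    let _ : Algebra (ZMod p) E := ZMod.algebra E p
    -- Descent to the prime field supplies the finiteness needed for commutative, perfect division
    -- rings in the blocks.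
    have h1 : HasInvariantIdempotents (Q.map (ringAutHom (ZMod p) K)) := h.descend
    obtain ⟨a, ha⟩ := hpow φ hφ
    refine fixedCentralCharactersTrivialOn_of_hasInvariantIdempotents (F := ZMod p) ha ?_
    have : IsArtinianRing (MonoidAlgebra (ZMod p) K) := IsArtinianRing.of_finite (ZMod p) _
    have : Finite (MulAut K) := Finite.of_injective _ (DFunLike.coe_injective (F := K ≃* K))
    have : Finite (Q.map (ringAutHom (ZMod p) K)) :=
      ((Q : Set (MulAut K)).toFinite.image (ringAutHom (ZMod p) K)).to_subtype
    refine (hQ.map (ringAutHom (ZMod p) K)).induction_normal h1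
      (fun H N hHN hN hC => hC.of_le_normalizer hHN hN) ?_
    rw [Subgroup.zpowers_le]
    exact ⟨φ, hφ, rfl⟩
  · intro h
    have h1 : HasInvariantIdempotents (Q.map (ringAutHom E K)) :=
      hasInvariantIdempotents_of_fixedCentralCharactersTrivialOn E Q fun φ hφ =>
        (hcongr φ hφ).1 (h φ hφ)
    exact h1.descend

/-- The orders of K and P are coprime with product |G|, as |P| is the index of K. -/
theorem isComplement'_of_isPComplement {G : Type*} [Group G] [Finite G] {p : ℕ} [Fact p.Prime]
    (P : Sylow p G) {K : Subgroup G} (hK : IsPComplement p K) :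
    Subgroup.IsComplement' K (P : Subgroup G) := by
  have hp := Fact.out (p := p.Prime)
  obtain ⟨hK, n, hn⟩ := hK
  have hcard := K.card_mul_index
  have hP : Nat.card P = p ^ n := by
    rw [P.card_eq_multiplicity, ← hcard, hn, Nat.factorization_mul Nat.card_pos.ne'
      (pow_pos hp.pos n).ne', Nat.factorization_pow]
    simp [hp.factorization, Nat.factorization_eq_zero_of_not_dvd hK]
  refine Subgroup.isComplement'_of_coprime ?_ ?_
  · rw [hP, ← hn, hcard]
  · rw [hP]
    exact ((Nat.Prime.coprime_iff_not_dvd hp).2 hK).symm.pow_right n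

theorem mainTheorem7 {G : Type*} [Group G] [Finite G] (p : ℕ) [Fact p.Prime]
    (F : Type*) [Field F] [CharP F p] (P : Sylow p G)
    (K : Subgroup G) [K.Normal] (hK : IsPComplement p K) :
    (inducedTrivial F (P : Subgroup G)).IsSemisimpleRepresentation ↔
      ∀ χ : Irr K, ∀ g ∈ inertiaGroup (P : Subgroup G) K χ.1, ∀ x : K,
        ((MulAut.conjNormal g x : K) : K ⧸ Irr.ker χ) = (x : K ⧸ Irr.ker χ) := by
  rw [isSemisimpleRepresentation_inducedTrivial_iff F (isComplement'_of_isPComplement P hK),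
    hasInvariantIdempotents_iff_fixedCentralCharactersTrivialOn hK.1 F (P.isPGroup'.map _),
    forall_irr_iff_fixedCentralCharactersTrivialOn]
  simp only [Subgroup.mem_map, forall_exists_index, and_imp, forall_apply_eq_imp_iff₂]
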